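/- **Theorem 1.** Consider $N$ followers with uncertain linear dynamics $$\dot x_i=(A_i+\Delta A_i)x_i+(B_i+\Delta B_i)u_i,\qquad y_i=(C_i+\Delta C_i)x_i+(D_i+\Delta D_i)u_i,\qquad i=1,\dots,N,$$ where $x_i\in\mathbb R^{n_i}$, $u_i\in\mathbb R^{p_i}$, $y_i\in\mathbb R^{q}$ and each $(C_i,A_i,B_i)$ is controllable and observable, and a leader $\dot v=Sv$, $y_0=-Fv$ with $v\in\mathbb R^m$ and $(F,S)$ observable. Let $w$ be the vector of all entries of $\Delta A_i,\Delta B_i,\Delta C_i,\Delta D_i$, $i=1,\dots,N$. Let $\mathcal G_1,\dots,\mathcal G_\kappa$ be weighted digraphs on the nodes $0,1,\dots,N$ (weights $a_{ij}\ge 0$, $a_{ii}=0$, $a_{0j}=0$, and $a_{ij}>0$ iff there is an arc from $j$ to $i$), each connected with the leader as its root: $a_{ij}=a_{ji}$ for all $i,j\ge 1$, and there is a directed path from node $0$ to every other node. Assume that for every $i$ and every eigenvalue $\lambda\in\mathbb C$ of $S$, $$\operatorname{rank}\begin{bmatrix}A_i-\lambda I&B_i\\ C_i&D_i\end{bmatrix}=n_i+q.$$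 Let $s^{p_m}+\alpha_1s^{p_m-1}+\dots+\alpha_{p_m}$ be the minimal polynomial of $S$, $G_1=I_q\otimes\beta$ and $G_2=I_q\otimes\gamma$ with $$\beta=\left[\begin{array}{c|c}0&I_{p_m-1}\\ \hline -\alpha_{p_m}&-\alpha_{p_m-1}\ \cdots\ -\alpha_1\end{array}\right],\qquad \gamma=\operatorname{col}(0,\dots,0,1)\in\mathbb R^{p_m}.$$ Then there are constant matrices $K_{1i},K_{2i}$ ($i=1,\dots,N$) and $L_0$, and an open neighbourhood $W$ of $w=0$, such that the following holds for every $w\in W$ and every switching signal $\sigma:[0,\infty)\to\{1,\dots,\kappa\}$ that is constant on the intervals $[t_k,t_{k+1})$ of a sequence $0=t_0<t_1<\cdots$ with $t_{k+1}-t_k\ge\tau_0$ for all $k$ and some dwell time $\tau_0>0$. Under the control law $$u_i=K_{1i}x_i+K_{2i}\xi_i,\qquad \dot\xi_i=G_1\xi_i+G_2(y_i+F\eta_i),\qquad \dot\eta_i=S\eta_i-L_0F\sum_{j=0}^Na_{ij}(t)(\eta_i-\eta_j),\qquad \eta_0=v,$$ where $a_{ij}(t)$ are the weights of $\mathcal G_{\sigma(t)}$,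 every closed-loop trajectory, whatever the initial values of $x_i,\xi_i,\eta_i,v$, satisfies $e_i(t)=y_i(t)-y_0(t)\to0$ as $t\to\infty$ for $i=1,\dots,N$. -/

import Mathlib

open scoped Matrix Kronecker Topology

noncomputable section

namespace ConsensusTracking

/-! ### Linear systems -/

/-- `(A, B)` is controllable: the Kalman matrix `[B, AB, …, A^(n-1) B]` has rank `n`. -/
def Controllable {n p : ℕ} (A : Matrix (Fin n) (Fin n) ℝ) (B : Matrix (Fin n) (Fin p) ℝ) : Prop :=
  (Matrix.of fun (i : Fin n) (kj : Fin n × Fin p) => (A ^ (kj.1 : ℕ) * B) i kj.2).rank = n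

/-- `(C, A)` is observable: the matrix `col(C, CA, …, C A^(n-1))` has rank `n`. -/
def Observable {n q : ℕ} (C : Matrix (Fin q) (Fin n) ℝ) (A : Matrix (Fin n) (Fin n) ℝ) : Prop :=
  (Matrix.of fun (ki : Fin n × Fin q) (j : Fin n) => (C * A ^ (ki.1 : ℕ)) ki.2 j).rank = n

/-- Data of a multi-agent system with `N` followers, output dimension `q` and leader dimension `m`:
nominal follower matrices `A i, B i, C i, D i` (state dimension `n i`, input dimension `p i`), and
the leader `v' = S v`, `y₀ = - F v`. -/
structure MultiAgentSystem (N q m : ℕ) where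
  n : Fin N → ℕ
  p : Fin N → ℕ
  A : ∀ i, Matrix (Fin (n i)) (Fin (n i)) ℝ
  B : ∀ i, Matrix (Fin (n i)) (Fin (p i)) ℝ
  C : ∀ i, Matrix (Fin q) (Fin (n i)) ℝ
  D : ∀ i, Matrix (Fin q) (Fin (p i)) ℝ
  S : Matrix (Fin m) (Fin m) ℝ
  F : Matrix (Fin q) (Fin m) ℝ

/-! ### Communication graphs and switching signals -/

/-- A weighted digraph on the nodes `0, 1, …, N` (node `0` is the leader, node `i.succ` is
follower `i`). The weight `a i j` is positive iff there is an arc from `j` to `i`; the leader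
receives no information. -/
structure CommGraph (N : ℕ) where
  a : Fin (N + 1) → Fin (N + 1) → ℝ
  nonneg : ∀ i j, 0 ≤ a i j
  diag : ∀ i, a i i = 0
  leader : ∀ j, a 0 j = 0

/-- The graph is connected with the leader as root: the subgraph of the followers is undirected
(with symmetric weights), and there is a directed path from the leader to every node. -/
def CommGraph.Connected {N : ℕ} (G : CommGraph N) : Prop :=
  (∀ i j : Fin N, G.a i.succ j.succ = G.a j.succ i.succ) ∧
    ∀ i : Fin (N + 1), Relation.ReflTransGen (fun j k => 0 < G.a k j) 0 i

/-- A piecewise constant switching signal `σ : [0, ∞) → {1, …, κ}` with switching instants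
`0 = t 0 < t 1 < …` and dwell time `τ₀`: it is constant on each `[t k, t (k+1))`.
(Only the values `σ s` with `0 ≤ s` matter.) -/
structure SwitchingSignal (κ : ℕ) (τ₀ : ℝ) where
  σ : ℝ → Fin κ
  t : ℕ → ℝ
  t_zero : t 0 = 0
  dwell : ∀ k, τ₀ ≤ t (k + 1) - t k
  const : ∀ k, ∀ s ∈ Set.Ico (t k) (t (k + 1)), σ s = σ (t k)

namespace MultiAgentSystem

variable {N q m : ℕ} (M : MultiAgentSystem N q m)

/-- The transmission zero condition: for every follower and every (complex) eigenvalue `z` of `S`,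
the matrix `[[A i - z I, B i], [C i, D i]]` has rank `n i + q`. -/
def TransmissionZeroCondition : Prop :=
  ∀ i : Fin N, ∀ z : ℂ,
    Module.End.HasEigenvalue (Matrix.toLin' (M.S.map (algebraMap ℝ ℂ))) z →
    (Matrix.fromBlocks
      ((M.A i).map (algebraMap ℝ ℂ) - z • (1 : Matrix (Fin (M.n i)) (Fin (M.n i)) ℂ))
      ((M.B i).map (algebraMap ℝ ℂ))
      ((M.C i).map (algebraMap ℝ ℂ))
      ((M.D i).map (algebraMap ℝ ℂ))).rank = M.n i + q

/-! ### Parameter uncertainty -/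

/-- The uncertain parameter `w = (w 1, …, w N)`, where `w i` collects the entries of
`[[ΔA i, ΔB i], [ΔC i, ΔD i]]`; it carries the usual finite-dimensional topology. -/
abbrev Uncertainty : Type :=
  ∀ i : Fin N, Matrix (Fin (M.n i) ⊕ Fin q) (Fin (M.n i) ⊕ Fin (M.p i)) ℝ

/-- `A i (w) = A i + ΔA i`. -/
def Aw (w : M.Uncertainty) (i : Fin N) : Matrix (Fin (M.n i)) (Fin (M.n i)) ℝ :=
  M.A i + (w i).toBlocks₁₁

/-- `B i (w) = B i + ΔB i`. -/
def Bw (w : M.Uncertainty) (i : Fin N) : Matrix (Fin (M.n i)) (Fin (M.p i)) ℝ :=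
  M.B i + (w i).toBlocks₁₂

/-- `C i (w) = C i + ΔC i`. -/
def Cw (w : M.Uncertainty) (i : Fin N) : Matrix (Fin q) (Fin (M.n i)) ℝ :=
  M.C i + (w i).toBlocks₂₁

/-- `D i (w) = D i + ΔD i`. -/
def Dw (w : M.Uncertainty) (i : Fin N) : Matrix (Fin q) (Fin (M.p i)) ℝ :=
  M.D i + (w i).toBlocks₂₂

/-! ### The `q`-copy internal model -/

/-- The degree `p_m` of the minimal polynomial of `S`. -/
def pm : ℕ := (minpoly ℝ M.S).natDegree

/-- The companion matrix `β` of the minimal polynomial of `S`: ones above the diagonal, and the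
negated coefficients of degrees `0, …, p_m - 1` in the last row. -/
def β : Matrix (Fin M.pm) (Fin M.pm) ℝ :=
  Matrix.of fun i j =>
    (if (i : ℕ) + 1 = j then 1 else 0) -
      (if (i : ℕ) + 1 = M.pm then (minpoly ℝ M.S).coeff j else 0)

/-- The column `γ = col(0, …, 0, 1)`. -/
def γ : Fin M.pm → ℝ := fun i => if (i : ℕ) + 1 = M.pm then 1 else 0

/-- `G₁ = I_q ⊗ β`. -/
def G₁ : Matrix (Fin q × Fin M.pm) (Fin q × Fin M.pm) ℝ :=
  (1 : Matrix (Fin q) (Fin q) ℝ) ⊗ₖ M.β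

/-- `G₂ = I_q ⊗ γ`, with the column index set `Fin q × {1}` identified with `Fin q`. -/
def G₂ : Matrix (Fin q × Fin M.pm) (Fin q) ℝ :=
  Matrix.of fun ij k => (1 : Matrix (Fin q) (Fin q) ℝ) ij.1 k * M.γ ij.2

/-! ### The closed loop under dynamic state feedback -/

/-- Gain matrices of the dynamic state feedback law. -/
structure Gains where
  K₁ : ∀ i, Matrix (Fin (M.p i)) (Fin (M.n i)) ℝ
  K₂ : ∀ i, Matrix (Fin (M.p i)) (Fin q × Fin M.pm) ℝ
  L₀ : Matrix (Fin m) (Fin q) ℝ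

/-- The signals of the closed loop: follower states `x i`, internal model states `ξ i`,
observer states `η i` and the leader state `v`, as functions of time. -/
structure Signals where
  x : ∀ i, ℝ → (Fin (M.n i) → ℝ)
  ξ : Fin N → ℝ → (Fin q × Fin M.pm → ℝ)
  η : Fin N → ℝ → (Fin m → ℝ)
  v : ℝ → (Fin m → ℝ)

variable {M}

namespace Signals

/-- The control input `u i = K₁ i x i + K₂ i ξ i`. -/
def u (z : M.Signals) (K : M.Gains) (i : Fin N) (t : ℝ) : Fin (M.p i) → ℝ :=
  K.K₁ i *ᵥ z.x i t + K.K₂ i *ᵥ z.ξ i t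

/-- The follower output `y i = C i (w) x i + D i (w) u i`. -/
def y (z : M.Signals) (K : M.Gains) (w : M.Uncertainty) (i : Fin N) (t : ℝ) : Fin q → ℝ :=
  M.Cw w i *ᵥ z.x i t + M.Dw w i *ᵥ z.u K i t

/-- The leader output `y₀ = - F v`. -/
def y₀ (z : M.Signals) (t : ℝ) : Fin q → ℝ := -(M.F *ᵥ z.v t)

/-- The tracking error `e i = y i - y₀`. -/
def e (z : M.Signals) (K : M.Gains) (w : M.Uncertainty) (i : Fin N) (t : ℝ) : Fin q → ℝ :=
  z.y K w i t - z.y₀ t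

/-- The observer states of all the nodes, with `η₀ = v` at the leader. -/
def ηAll (z : M.Signals) (t : ℝ) : Fin (N + 1) → (Fin m → ℝ) :=
  Fin.cons (z.v t) fun i => z.η i t

/-- The relative information `η_{vi} = ∑_{j=0}^N a_{ij} (η i - η j)` in the graph `G`. -/
def ηv (z : M.Signals) (G : CommGraph N) (i : Fin N) (t : ℝ) : Fin m → ℝ :=
  ∑ j : Fin (N + 1), G.a i.succ j • (z.η i t - z.ηAll t j)

/-- `z` is a trajectory of the closed loop on `[0, ∞)`, with arbitrary initial values: it is
continuous, and on every interval `[t k, t (k+1))` between switching instants it is differentiable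
and satisfies the equations of the leader, the followers and the control law. -/
structure IsTrajectory {κ : ℕ} {τ₀ : ℝ} (z : M.Signals) (K : M.Gains) (w : M.Uncertainty)
    (G : Fin κ → CommGraph N) (s : SwitchingSignal κ τ₀) : Prop where
  cont_v : ContinuousOn z.v (Set.Ici 0)
  cont_x : ∀ i, ContinuousOn (z.x i) (Set.Ici 0)
  cont_ξ : ∀ i, ContinuousOn (z.ξ i) (Set.Ici 0)
  cont_η : ∀ i, ContinuousOn (z.η i) (Set.Ici 0)
  deriv_v : ∀ k, ∀ t ∈ Set.Ico (s.t k) (s.t (k + 1)),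
    HasDerivWithinAt z.v (M.S *ᵥ z.v t) (Set.Ico (s.t k) (s.t (k + 1))) t
  deriv_x : ∀ i k, ∀ t ∈ Set.Ico (s.t k) (s.t (k + 1)),
    HasDerivWithinAt (z.x i) (M.Aw w i *ᵥ z.x i t + M.Bw w i *ᵥ z.u K i t)
      (Set.Ico (s.t k) (s.t (k + 1))) t
  deriv_ξ : ∀ i k, ∀ t ∈ Set.Ico (s.t k) (s.t (k + 1)),
    HasDerivWithinAt (z.ξ i) (M.G₁ *ᵥ z.ξ i t + M.G₂ *ᵥ (z.y K w i t + M.F *ᵥ z.η i t))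
      (Set.Ico (s.t k) (s.t (k + 1))) t
  deriv_η : ∀ i k, ∀ t ∈ Set.Ico (s.t k) (s.t (k + 1)),
    HasDerivWithinAt (z.η i) (M.S *ᵥ z.η i t - K.L₀ *ᵥ (M.F *ᵥ z.ηv (G (s.σ t)) i t))
      (Set.Ico (s.t k) (s.t (k + 1))) t

end Signals

/-- The control law with gains `K` solves the robust consensus tracking problem over the graphs
`G`: there is an open neighbourhood `W` of `w = 0` such that, for every `w ∈ W`, every switching
signal with a positive dwell time and every trajectory of the closed loop (hence for all initial
conditions), all the tracking errors tend to `0`. -/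
def SolvesRobustConsensusTracking {κ : ℕ} (K : M.Gains) (G : Fin κ → CommGraph N) : Prop :=
  ∃ W : Set M.Uncertainty, IsOpen W ∧ (0 : M.Uncertainty) ∈ W ∧
    ∀ w ∈ W, ∀ (τ₀ : ℝ), 0 < τ₀ → ∀ (s : SwitchingSignal κ τ₀) (z : M.Signals),
      z.IsTrajectory K w G s →
        ∀ i : Fin N, Filter.Tendsto (fun t => z.e K w i t) Filter.atTop (𝓝 0)

end MultiAgentSystem

end ConsensusTracking

end

/-!
The gains decouple. For the observer, `F, S` observable gives a positive definite `Q` with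
`Q S + Sᵀ Q ≤ Fᵀ F - 2 Q` (a finite-horizon Gramian, `exists_posDef_of_observable`). The grounded
Laplacian of each graph is symmetric and positive definite, so with `L₀ = μ Q⁻¹ Fᵀ` and `μ` large the
form `∑ (η i - v)ᵀ Q (η i - v)` decays exponentially, at the same rate in all the graphs
(`exists_observer_gain`).

For a follower, the plant in series with the internal model is controllable: this is the eigenvector
test together with the transmission zero condition (`augmented_controllable`). The dual Gramian gives
a stabilizing feedback with a quadratic Lyapunov function `P` (`exists_gain_of_controllable`), and the
decay of `P` persists for all small `w` (`eventually_decay`); these `w` form the neighbourhood `W`.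

It remains to see that the error is not excited by `v`. Let `p` be the minimal polynomial of `S`, let
`A_c` be the closed-loop matrix of the joint state `z = (x, ξ)`, and let `E` be the input matrix of the
leader. Since `p(S) = 0`, the polynomial `p` of `[[A_c, E], [0, S]]` has the form `[[R, Y], [0, 0]]`, and
it commutes with that matrix. Hence `ρ = R z + Y v` satisfies `ρ' = A_c ρ + R E (η - v)`, without any
forcing by `v`. The internal model consists of chains of integrators closed by the coefficients of `p`
and driven by the error, so the components of the error are components of `ρ`
(`exists_internal_model_error`). This requires neither the solvability of the regulator equations nor
an assumption on the spectrum of `S`.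

The sum of `ρᵀ P ρ` and a multiple of the observer form is then a common Lyapunov function along every
switching signal (`tendsto_error`), and the dwell time makes the switching instants exhaust `[0, ∞)`
(`SwitchingSignal.tendsto_zero`).
-/

/-! ### Quadratic forms -/

section QuadraticForms

/-- Compactness of the unit sphere: a positive definite homogeneous function of degree two dominates
every other continuous homogeneous function of degree two. -/
theorem exists_le_mul_of_homogeneous {ι : Type*} [Fintype ι] {f g : (ι → ℝ) → ℝ}
    (hf : Continuous f) (hg : Continuous g)
    (hf2 : ∀ (c : ℝ) x, f (c • x) = c ^ 2 * f x) (hg2 : ∀ (c : ℝ) x, g (c • x) = c ^ 2 * g x)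
    (hpos : ∀ x, x ≠ 0 → 0 < g x) : ∃ k, 0 < k ∧ ∀ x, f x ≤ k * g x := by
  have hne : ∀ x ∈ Metric.sphere (0 : ι → ℝ) 1, x ≠ 0 := fun x hx h => by simp [h] at hx
  obtain ⟨k, hk⟩ := ((isCompact_sphere (0 : ι → ℝ) 1).image_of_continuousOn
    (hf.continuousOn.div hg.continuousOn fun x hx => (hpos x (hne x hx)).ne')).bddAbove
  refine ⟨max k 1, by positivity, fun x => ?_⟩
  by_cases hx : x = 0
  · have h0 : f 0 = 0 := by simpa using hf2 0 0
    have h1 : g 0 = 0 := by simpa using hg2 0 0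
    rw [hx, h0, h1, mul_zero]
  · have hn : ‖x‖ ≠ 0 := norm_ne_zero_iff.2 hx
    set y := ‖x‖⁻¹ • x with hy
    have hys : y ∈ Metric.sphere (0 : ι → ℝ) 1 := by simp [hy, norm_smul, hn]
    have hxy : x = ‖x‖ • y := by rw [hy, smul_smul, mul_inv_cancel₀ hn, one_smul]
    have h1 : f y / g y ≤ k := hk ⟨y, hys, rfl⟩
    have hgy := hpos y (hne y hys)
    rw [div_le_iff₀ hgy] at h1
    have h2 : f y ≤ max k 1 * g y := h1.trans (by gcongr; exact le_max_left _ _)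
    rw [hxy, hf2, hg2]
    nlinarith [sq_nonneg ‖x‖]

variable {ι : Type*} [Fintype ι]

theorem quadForm_smul (R : Matrix ι ι ℝ) (c : ℝ) (x : ι → ℝ) :
    (c • x) ⬝ᵥ R *ᵥ (c • x) = c ^ 2 * (x ⬝ᵥ R *ᵥ x) := by
  rw [Matrix.mulVec_smul, smul_dotProduct, dotProduct_smul, smul_eq_mul, smul_eq_mul]; ring

theorem Matrix.PosDef.quadForm_pos {P : Matrix ι ι ℝ} (hP : P.PosDef) {x : ι → ℝ} (hx : x ≠ 0) :
    0 < x ⬝ᵥ P *ᵥ x := by simpa using hP.dotProduct_mulVec_pos hx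

theorem Matrix.PosDef.quadForm_nonneg {P : Matrix ι ι ℝ} (hP : P.PosDef) (x : ι → ℝ) :
    0 ≤ x ⬝ᵥ P *ᵥ x := by simpa using hP.posSemidef.dotProduct_mulVec_nonneg x

theorem Matrix.PosDef.exists_quadForm_le {P : Matrix ι ι ℝ} (hP : P.PosDef) (R : Matrix ι ι ℝ) :
    ∃ k, 0 < k ∧ ∀ x : ι → ℝ, x ⬝ᵥ R *ᵥ x ≤ k * (x ⬝ᵥ P *ᵥ x) :=
  exists_le_mul_of_homogeneous (by fun_prop) (by fun_prop) (quadForm_smul R) (quadForm_smul P)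
    fun _ hx => hP.quadForm_pos hx

theorem Matrix.PosDef.dotProduct_mulVec_comm {P : Matrix ι ι ℝ} (hP : P.PosDef) (x y : ι → ℝ) :
    x ⬝ᵥ P *ᵥ y = y ⬝ᵥ P *ᵥ x := by
  have h : Pᵀ = P := by simpa using hP.isHermitian.eq
  rw [Matrix.dotProduct_mulVec, ← Matrix.mulVec_transpose, h, dotProduct_comm]

/-- Young's inequality for the inner product of a positive definite matrix. -/
theorem Matrix.PosDef.two_mul_dotProduct_le {P : Matrix ι ι ℝ} (hP : P.PosDef) (x y : ι → ℝ) :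
    2 * (x ⬝ᵥ P *ᵥ y) ≤ 1 / 2 * (x ⬝ᵥ P *ᵥ x) + 2 * (y ⬝ᵥ P *ᵥ y) := by
  have h := hP.quadForm_nonneg (x - (2 : ℝ) • y)
  simp only [Matrix.mulVec_sub, sub_dotProduct, dotProduct_sub, Matrix.mulVec_smul,
    smul_dotProduct, dotProduct_smul, smul_eq_mul, hP.dotProduct_mulVec_comm y x] at h
  linarith

theorem HasDerivWithinAt.dotProduct {f g : ℝ → ι → ℝ} {f' g' : ι → ℝ} {s : Set ℝ} {t : ℝ}
    (hf : HasDerivWithinAt f f' s t) (hg : HasDerivWithinAt g g' s t) :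
    HasDerivWithinAt (fun τ => f τ ⬝ᵥ g τ) (f' ⬝ᵥ g t + f t ⬝ᵥ g') s t := by
  rw [hasDerivWithinAt_pi] at hf hg
  simp only [_root_.dotProduct, ← Finset.sum_add_distrib]
  exact HasDerivWithinAt.fun_sum fun i _ => (hf i).mul (hg i)

theorem HasDerivWithinAt.mulVec {κ : Type*} (P : Matrix κ ι ℝ) {f : ℝ → ι → ℝ} {f' : ι → ℝ} {s : Set ℝ}
    {t : ℝ} (hf : HasDerivWithinAt f f' s t) :
    HasDerivWithinAt (fun τ => P *ᵥ f τ) (P *ᵥ f') s t := by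
  rw [hasDerivWithinAt_pi] at hf ⊢
  intro i
  simp only [Matrix.mulVec, _root_.dotProduct]
  exact HasDerivWithinAt.fun_sum fun j _ => (hf j).const_mul _

theorem Matrix.PosDef.hasDerivWithinAt_quadForm {P : Matrix ι ι ℝ} (hP : P.PosDef) {f : ℝ → ι → ℝ}
    {f' : ι → ℝ} {s : Set ℝ} {t : ℝ} (hf : HasDerivWithinAt f f' s t) :
    HasDerivWithinAt (fun τ => f τ ⬝ᵥ P *ᵥ f τ) (2 * (f t ⬝ᵥ P *ᵥ f')) s t := by
  convert hf.dotProduct (hf.mulVec P) using 1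
  rw [hP.dotProduct_mulVec_comm f' (f t)]; ring

theorem Matrix.PosDef.tendsto_zero_of_quadForm {P : Matrix ι ι ℝ} (hP : P.PosDef) {f : ℝ → ι → ℝ}
    (h : Filter.Tendsto (fun t => f t ⬝ᵥ P *ᵥ f t) Filter.atTop (𝓝 0)) :
    Filter.Tendsto f Filter.atTop (𝓝 0) := by
  classical
  rw [tendsto_pi_nhds]
  intro i
  obtain ⟨k, -, hle⟩ := hP.exists_quadForm_le 1
  have h1 : Filter.Tendsto (fun t => f t i ^ 2) Filter.atTop (𝓝 0) := by
    refine squeeze_zero (fun t => sq_nonneg _) (fun t => ?_) (by simpa using h.const_mul k)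
    refine le_trans ?_ (hle (f t))
    rw [Matrix.one_mulVec, sq]
    exact Finset.single_le_sum (f := fun j => f t j * f t j) (fun j _ => mul_self_nonneg _)
      (Finset.mem_univ i)
  have h2 := h1.sqrt
  simp only [Real.sqrt_sq_eq_abs, Real.sqrt_zero] at h2
  exact (tendsto_zero_iff_abs_tendsto_zero _).2 h2

end QuadraticForms

/-! ### Exponential decay along a switching signal -/

theorem ConsensusTracking.SwitchingSignal.mul_le_t {n : ℕ} {τ₀ : ℝ} (s : ConsensusTracking.SwitchingSignal n τ₀) (k : ℕ) :
    k * τ₀ ≤ s.t k := by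
  induction k with
  | zero => simp [s.t_zero]
  | succ k ih => have := s.dwell k; push_cast; linarith

/-- The dwell time is what makes the switching instants exhaust `[0, ∞)`, so that a differential
inequality on the intervals between them controls the limit at infinity. -/
theorem ConsensusTracking.SwitchingSignal.tendsto_zero {n : ℕ} {τ₀ : ℝ} (hτ : 0 < τ₀)
    (s : ConsensusTracking.SwitchingSignal n τ₀)
    {f : ℝ → ℝ} {c : ℝ} (hc : 0 < c) (hf : ContinuousOn f (Set.Ici 0)) (hnn : ∀ t, 0 ≤ f t)
    (hd : ∀ k, ∀ t ∈ Set.Ico (s.t k) (s.t (k + 1)), ∃ f',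
      HasDerivWithinAt f f' (Set.Ico (s.t k) (s.t (k + 1))) t ∧ f' ≤ -c * f t) :
    Filter.Tendsto f Filter.atTop (𝓝 0) := by
  have ht0 : ∀ k, 0 ≤ s.t k := fun k => le_trans (by positivity) (s.mul_le_t k)
  set g : ℝ → ℝ := fun t => Real.exp (c * t) * f t with hg
  have hanti : ∀ k, AntitoneOn g (Set.Icc (s.t k) (s.t (k + 1))) := by
    intro k
    have hder : ∀ t ∈ Set.Ioo (s.t k) (s.t (k + 1)), ∃ g', HasDerivAt g g' t ∧ g' ≤ 0 := by
      intro t ht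
      obtain ⟨f', h1, h2⟩ := hd k t ⟨ht.1.le, ht.2⟩
      have h3 : HasDerivAt f f' t := h1.hasDerivAt (Ico_mem_nhds ht.1 ht.2)
      have h4 : HasDerivAt (fun t => Real.exp (c * t)) (Real.exp (c * t) * c) t := by
        simpa using ((hasDerivAt_id t).const_mul c).exp
      refine ⟨_, h4.mul h3, ?_⟩
      have := Real.exp_pos (c * t)
      nlinarith
    refine antitoneOn_of_deriv_nonpos (convex_Icc _ _) ?_ ?_ ?_
    · exact (by fun_prop : Continuous fun t => Real.exp (c * t)).continuousOn.mul
        (hf.mono fun t ht => (ht0 k).trans ht.1)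
    · rw [interior_Icc]
      intro t ht
      obtain ⟨g', h, -⟩ := hder t ht
      exact h.differentiableAt.differentiableWithinAt
    · rw [interior_Icc]
      intro t ht
      obtain ⟨g', h, h'⟩ := hder t ht
      rwa [h.deriv]
  have hstep : ∀ k, s.t k ≤ s.t (k + 1) := fun k => by linarith [s.dwell k]
  have hbound : ∀ k, ∀ t ∈ Set.Icc (s.t k) (s.t (k + 1)), g t ≤ g 0 := by
    intro k
    induction k with
    | zero =>
      intro t ht
      have := hanti 0 ⟨le_rfl, hstep 0⟩ ht ht.1
      rwa [s.t_zero] at this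
    | succ k ih =>
      intro t ht
      exact (hanti (k + 1) ⟨le_rfl, hstep _⟩ ht ht.1).trans (ih _ ⟨hstep k, le_rfl⟩)
  have hall : ∀ t, 0 ≤ t → g t ≤ g 0 := by
    intro t ht
    obtain ⟨K, hK⟩ := exists_nat_gt (t / τ₀)
    rw [div_lt_iff₀ hτ] at hK
    have hex : ∃ k, t < s.t k := ⟨K, hK.trans_le (s.mul_le_t K)⟩
    classical
    obtain ⟨k, hk⟩ : ∃ k, Nat.find hex = k + 1 := by
      refine Nat.exists_eq_succ_of_ne_zero fun h => ?_
      have := Nat.find_spec hex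
      rw [h, s.t_zero] at this
      linarith
    refine hbound k t ⟨not_lt.1 (Nat.find_min hex (by omega)), ?_⟩
    have := Nat.find_spec hex
    rw [hk] at this
    exact this.le
  have hlim : Filter.Tendsto (fun t => g 0 * Real.exp (-(c * t))) Filter.atTop (𝓝 0) := by
    have h1 : Filter.Tendsto (fun t : ℝ => c * t) Filter.atTop Filter.atTop :=
      Filter.tendsto_id.const_mul_atTop hc
    simpa using (Real.tendsto_exp_neg_atTop_nhds_zero.comp h1).const_mul (g 0)
  refine squeeze_zero' (Filter.Eventually.of_forall hnn) ?_ hlim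
  filter_upwards [Filter.eventually_ge_atTop 0] with t ht
  rw [Real.exp_neg, ← div_eq_mul_inv, le_div_iff₀ (Real.exp_pos _), mul_comm]
  exact hall t ht

/-! ### Gramians and observability -/

section Gramian

open scoped Matrix.Norms.Operator

variable {ι κ : Type*} [Fintype ι] [Fintype κ] [DecidableEq ι]

/-- An observable pair `(C, A)` has a positive definite `P` with `P A + Aᵀ P ≤ Cᵀ C - 2 P`. The witness
is the finite-horizon Gramian `P = ∫₀¹ E(t)ᵀ Cᵀ C E(t) dt` with `E(t) = exp(-t (A + 1))`: integrating
the derivative of the integrand gives `(A + 1)ᵀ P + P (A + 1) = Cᵀ C - E(1)ᵀ Cᵀ C E(1)`, and no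
stability of `A` is needed because the horizon is finite. -/
theorem exists_posDef_of_observable (A : Matrix ι ι ℝ) (C : Matrix κ ι ℝ)
    (h : ∀ x : ι → ℝ, (∀ k : ℕ, C *ᵥ (A ^ k *ᵥ x) = 0) → x = 0) :
    ∃ P : Matrix ι ι ℝ, P.PosDef ∧ ∀ x : ι → ℝ,
      2 * (x ⬝ᵥ P *ᵥ (A *ᵥ x)) ≤ (C *ᵥ x) ⬝ᵥ (C *ᵥ x) - 2 * (x ⬝ᵥ P *ᵥ x) := by
  set B : Matrix ι ι ℝ := -(A + 1) with hB
  set E : ℝ → Matrix ι ι ℝ := fun t => NormedSpace.exp (t • B) with hE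
  have hE' : ∀ t, HasDerivAt E (E t * B) t := fun t => hasDerivAt_exp_smul_const B t
  have hBx : ∀ x, B *ᵥ x = -(A *ᵥ x) - x := fun x => by
    rw [hB, Matrix.neg_mulVec, Matrix.add_mulVec, Matrix.one_mulVec]; abel
  have hcE : Continuous E := continuous_iff_continuousAt.2 fun t => (hE' t).continuousAt
  have hcomm : ∀ t, A * E t = E t * A := fun t => by
    have h1 : Commute A B := ((Commute.refl A).add_right (Commute.one_right A)).neg_right
    exact (h1.smul_right t).exp_right
  have hinj : ∀ t x, E t *ᵥ x = 0 → x = 0 := fun t x hx => by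
    have hu : IsUnit (E t) := Matrix.isUnit_exp _
    exact Matrix.mulVec_injective_of_isUnit hu (by simpa using hx)
  have hcW : Continuous fun t => (E t)ᵀ * (Cᵀ * C) * E t := by fun_prop
  have hWq : ∀ t x, x ⬝ᵥ ((E t)ᵀ * (Cᵀ * C) * E t) *ᵥ x =
      (C *ᵥ (E t *ᵥ x)) ⬝ᵥ (C *ᵥ (E t *ᵥ x)) := by
    intro t x
    simp only [← Matrix.mulVec_mulVec, Matrix.dotProduct_mulVec, Matrix.vecMul_transpose]
  set P : Matrix ι ι ℝ := ∫ t in (0:ℝ)..1, (E t)ᵀ * (Cᵀ * C) * E t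
  -- The integral is evaluated through linear functionals of the matrix.
  have hlin : ∀ φ : Matrix ι ι ℝ →ₗ[ℝ] ℝ, φ P = ∫ t in (0:ℝ)..1, φ ((E t)ᵀ * (Cᵀ * C) * E t) :=
    fun φ => (φ.toContinuousLinearMap.intervalIntegral_comp_comm
      (hcW.intervalIntegrable 0 1)).symm
  have hP : ∀ x y, x ⬝ᵥ P *ᵥ y = ∫ t in (0:ℝ)..1, x ⬝ᵥ ((E t)ᵀ * (Cᵀ * C) * E t) *ᵥ y :=
    fun x y => hlin
      { toFun := fun R => x ⬝ᵥ R *ᵥ y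
        map_add' := fun R R' => by rw [Matrix.add_mulVec, dotProduct_add]
        map_smul' := fun c R => by rw [Matrix.smul_mulVec, dotProduct_smul]; rfl }
  have hcq : ∀ x, Continuous fun t => (C *ᵥ (E t *ᵥ x)) ⬝ᵥ (C *ᵥ (E t *ᵥ x)) := by
    intro x; fun_prop
  have hder : ∀ (x : ι → ℝ) t, HasDerivAt (fun t => C *ᵥ (E t *ᵥ x))
      (C *ᵥ (E t *ᵥ (B *ᵥ x))) t := by
    intro x t
    let φ : Matrix ι ι ℝ →ₗ[ℝ] (κ → ℝ) :=
      { toFun := fun R => C *ᵥ (R *ᵥ x)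
        map_add' := fun R R' => by rw [Matrix.add_mulVec, Matrix.mulVec_add]
        map_smul' := fun c R => by rw [Matrix.smul_mulVec, Matrix.mulVec_smul]; rfl }
    have := φ.toContinuousLinearMap.hasFDerivAt.comp_hasDerivAt t (hE' t)
    rw [Matrix.mulVec_mulVec x (E t) B]
    exact this
  have hsymm : P.IsHermitian := by
    refine Matrix.IsHermitian.ext fun i j => ?_
    have h1 := hP (Pi.single i 1) (Pi.single j 1)
    have h2 := hP (Pi.single j 1) (Pi.single i 1)
    simp only [Matrix.mulVec_single_one, single_one_dotProduct, Matrix.col_apply] at h1 h2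
    rw [star_trivial, h1, h2]
    congr 1
    ext t
    have : ((E t)ᵀ * (Cᵀ * C) * E t)ᵀ = (E t)ᵀ * (Cᵀ * C) * E t := by
      simp only [Matrix.transpose_mul, Matrix.transpose_transpose, Matrix.mul_assoc]
    conv_lhs => rw [← this]
    rfl
  refine ⟨P, Matrix.PosDef.of_dotProduct_mulVec_pos hsymm fun x hx => ?_, fun x => ?_⟩
  · rw [star_trivial, hP]
    simp only [hWq]
    have hnn : ∀ t, 0 ≤ (C *ᵥ (E t *ᵥ x)) ⬝ᵥ (C *ᵥ (E t *ᵥ x)) := fun t =>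
      Finset.sum_nonneg fun i _ => mul_self_nonneg _
    refine lt_of_le_of_ne (intervalIntegral.integral_nonneg zero_le_one fun t _ => hnn t) ?_
    intro h0
    -- A vanishing integral forces `C E(t) x = 0` on `(0, 1)`. Differentiating replaces `x` by `A x`,
    -- so that `C E(t) A ^ k x = 0` for all `k`, and observability applies to `E(1/2) x`.
    have hz : ∀ t ∈ Set.Ioo (0 : ℝ) 1, C *ᵥ (E t *ᵥ x) = 0 := by
      intro t ht
      by_contra hne
      refine (intervalIntegral.integral_pos zero_lt_one (hcq x).continuousOn (fun t _ => hnn t)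
        ⟨t, ⟨ht.1.le, ht.2.le⟩, lt_of_le_of_ne (hnn t) fun h => hne ?_⟩).ne h0
      exact dotProduct_self_eq_zero.1 h.symm
    have hk : ∀ k : ℕ, ∀ t ∈ Set.Ioo (0 : ℝ) 1, C *ᵥ (E t *ᵥ (A ^ k *ᵥ x)) = 0 := by
      intro k
      induction k with
      | zero => simpa using hz
      | succ k ih =>
        intro t ht
        have h2 : HasDerivAt (fun t => C *ᵥ (E t *ᵥ (A ^ k *ᵥ x))) 0 t :=
          (hasDerivAt_const t (0 : κ → ℝ)).congr_of_eventuallyEq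
            (Filter.eventually_of_mem (Ioo_mem_nhds ht.1 ht.2) ih)
        have h3 := (hder (A ^ k *ᵥ x) t).unique h2
        rw [hBx, Matrix.mulVec_sub, Matrix.mulVec_sub, ih t ht, sub_zero, Matrix.mulVec_neg,
          Matrix.mulVec_neg, neg_eq_zero] at h3
        rwa [pow_succ', ← Matrix.mulVec_mulVec]
    refine hx (hinj (1 / 2) x (h _ fun k => ?_))
    have h1 := hk k (1 / 2) (by norm_num)
    have h2 : Commute (A ^ k) (E (1 / 2)) := Commute.pow_left (hcomm _) k
    rwa [Matrix.mulVec_mulVec x (E (1 / 2)), ← h2.eq, ← Matrix.mulVec_mulVec] at h1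
  · have h1 : ∀ t, HasDerivAt (fun t => (C *ᵥ (E t *ᵥ x)) ⬝ᵥ (C *ᵥ (E t *ᵥ x)))
        (2 * (x ⬝ᵥ ((E t)ᵀ * (Cᵀ * C) * E t) *ᵥ (B *ᵥ x))) t := by
      intro t
      have h := (hder x t).hasDerivWithinAt (s := Set.univ)
      refine ((h.dotProduct h).hasDerivAt Filter.univ_mem).congr_deriv ?_
      rw [dotProduct_comm (C *ᵥ (E t *ᵥ (B *ᵥ x)))]
      simp only [← Matrix.mulVec_mulVec, Matrix.dotProduct_mulVec, Matrix.vecMul_transpose]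
      ring
    have h2 := intervalIntegral.integral_eq_sub_of_hasDerivAt (a := 0) (b := 1)
      (fun t _ => h1 t) (Continuous.intervalIntegrable (by fun_prop) _ _)
    rw [intervalIntegral.integral_const_mul, ← hP] at h2
    have h4 : 0 ≤ (C *ᵥ (E 1 *ᵥ x)) ⬝ᵥ (C *ᵥ (E 1 *ᵥ x)) :=
      Finset.sum_nonneg fun i _ => mul_self_nonneg _
    have h5 : E 0 = 1 := by simp [hE]
    rw [hBx, h5, Matrix.one_mulVec, Matrix.mulVec_sub, Matrix.mulVec_neg, dotProduct_sub,
      dotProduct_neg] at h2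
    linarith

end Gramian

theorem Matrix.map_ofReal_mulVec {ι κ : Type*} [Fintype ι] (R : Matrix κ ι ℝ) (y : ι → ℝ) :
    R.map (algebraMap ℝ ℂ) *ᵥ (fun i => (y i : ℂ)) = fun i => ((R *ᵥ y) i : ℂ) := by
  ext i
  simp [Matrix.mulVec, dotProduct]

/-- The Popov–Belevitch–Hautus test: if no complex eigenvector of `A` lies in the kernel of `C`, the
unobservable subspace vanishes. -/
theorem observable_of_forall_eigenvector {ι κ : Type*} [Fintype ι] [Fintype κ] [DecidableEq ι]
    (A : Matrix ι ι ℝ) (C : Matrix κ ι ℝ)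
    (h : ∀ (l : ℂ) (z : ι → ℂ), A.map (algebraMap ℝ ℂ) *ᵥ z = l • z →
      C.map (algebraMap ℝ ℂ) *ᵥ z = 0 → z = 0) (x : ι → ℝ)
    (hx : ∀ k : ℕ, C *ᵥ (A ^ k *ᵥ x) = 0) : x = 0 := by
  set Ac := A.map (algebraMap ℝ ℂ) with hAc
  set Cc := C.map (algebraMap ℝ ℂ) with hCc
  -- The unobservable subspace of the complexified pair is invariant, hence contains an eigenvector
  -- unless it is trivial.
  let V : Submodule ℂ (ι → ℂ) := ⨅ k : ℕ, LinearMap.ker (Cc * Ac ^ k).mulVecLin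
  have hV : ∀ z, z ∈ V ↔ ∀ k : ℕ, Cc *ᵥ (Ac ^ k *ᵥ z) = 0 := by
    intro z; simp [V, Submodule.mem_iInf, Matrix.mulVec_mulVec]
  have hinv : ∀ z ∈ V, Matrix.toLin' Ac z ∈ V := by
    intro z hz
    rw [hV] at hz ⊢
    intro k
    have := hz (k + 1)
    rwa [pow_succ, ← Matrix.mulVec_mulVec] at this
  have hxV : (fun i => (x i : ℂ)) ∈ V := by
    rw [hV]
    intro k
    rw [hAc, ← Matrix.map_pow, hCc, Matrix.map_ofReal_mulVec, Matrix.map_ofReal_mulVec, hx k]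
    ext i; simp
  by_contra hne
  have hnt : Nontrivial V := by
    refine ⟨⟨⟨_, hxV⟩, 0, fun h0 => hne ?_⟩⟩
    ext i
    have := congrFun (congrArg Subtype.val h0) i
    simpa using this
  obtain ⟨l, hl⟩ := Module.End.exists_eigenvalue ((Matrix.toLin' Ac).restrict hinv)
  obtain ⟨z, hz⟩ := hl.exists_hasEigenvector
  have h1 : Ac *ᵥ (z : ι → ℂ) = l • (z : ι → ℂ) := by
    have := congrArg Subtype.val hz.apply_eq_smul
    simpa using this
  have h2 : Cc *ᵥ (z : ι → ℂ) = 0 := by simpa using (hV z).1 z.2 0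
  exact hz.2 (Subtype.ext (h l z h1 h2))

/-! ### Stabilization -/

/-- A controllable pair has a feedback gain `K` and a quadratic Lyapunov function `P` with
`P (A + B K) + (A + B K)ᵀ P ≤ -2 P`. With `W` the Gramian of the dual pair, `P = W⁻¹` and
`K = -Bᵀ W⁻¹`. The explicit decay rate leaves room for perturbations of the system. -/
theorem exists_gain_of_controllable {ι κ : Type*} [Fintype ι] [Fintype κ] [DecidableEq ι]
    (A : Matrix ι ι ℝ) (B : Matrix ι κ ℝ)
    (h : ∀ y : ι → ℝ, (∀ k : ℕ, Bᵀ *ᵥ (Aᵀ ^ k *ᵥ y) = 0) → y = 0) :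
    ∃ (K : Matrix κ ι ℝ) (P : Matrix ι ι ℝ), P.PosDef ∧ ∀ z : ι → ℝ,
      2 * (z ⬝ᵥ P *ᵥ ((A + B * K) *ᵥ z)) ≤ -2 * (z ⬝ᵥ P *ᵥ z) := by
  obtain ⟨W, hW, hle⟩ := exists_posDef_of_observable Aᵀ Bᵀ h
  have hu : IsUnit W.det := (Matrix.isUnit_iff_isUnit_det _).1 hW.isUnit
  refine ⟨-(Bᵀ * W⁻¹), W⁻¹, hW.inv, fun z => ?_⟩
  set y := W⁻¹ *ᵥ z with hy
  have hz : z = W *ᵥ y := by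
    rw [hy, Matrix.mulVec_mulVec, Matrix.mul_nonsing_inv _ hu, Matrix.one_mulVec]
  have h1 : ∀ x, z ⬝ᵥ W⁻¹ *ᵥ x = y ⬝ᵥ x := fun x => by
    rw [hW.inv.dotProduct_mulVec_comm, dotProduct_comm]
  have h2 : y ⬝ᵥ A *ᵥ z = y ⬝ᵥ W *ᵥ (Aᵀ *ᵥ y) := by
    rw [hW.dotProduct_mulVec_comm, ← hz, Matrix.dotProduct_mulVec, Matrix.mulVec_transpose]
  have h3 : y ⬝ᵥ (B * (-(Bᵀ * W⁻¹))) *ᵥ z = -((Bᵀ *ᵥ y) ⬝ᵥ (Bᵀ *ᵥ y)) := by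
    rw [Matrix.mul_neg, Matrix.neg_mulVec, dotProduct_neg, ← Matrix.mulVec_mulVec,
      ← Matrix.mulVec_mulVec, ← hy, Matrix.dotProduct_mulVec, Matrix.mulVec_transpose]
  have h4 : 0 ≤ (Bᵀ *ᵥ y) ⬝ᵥ (Bᵀ *ᵥ y) := Finset.sum_nonneg fun i _ => mul_self_nonneg _
  have h5 : y ⬝ᵥ z = y ⬝ᵥ W *ᵥ y := by rw [← hz]
  rw [h1, h1, Matrix.add_mulVec, dotProduct_add, h2, h3, h5]
  linarith [hle y]

/-! ### Communication graphs -/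

/-- The grounded Laplacian of a connected graph is positive definite. The leader is pinned to the
value `0`, and by symmetry of the follower weights the form is
`∑ a_{i0} y_i² + ½ ∑ a_{ij} (y_i - y_j)²`. -/
theorem ConsensusTracking.CommGraph.Connected.exists_coercive {N : ℕ}
    {G : ConsensusTracking.CommGraph N} (hG : G.Connected) :
    ∃ k, 0 < k ∧ ∀ y : Fin N → ℝ, ∑ i, y i ^ 2 ≤
      k * ∑ i : Fin N, y i * ∑ j : Fin (N + 1),
        G.a i.succ j * (y i - (Fin.cons 0 y : Fin (N + 1) → ℝ) j) := by
  obtain ⟨hsym, hpath⟩ := hG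
  refine exists_le_mul_of_homogeneous (by fun_prop) ?_ ?_ ?_ ?_
  · simp only [Fin.sum_univ_succ, Fin.cons_zero, Fin.cons_succ]
    fun_prop
  · intro c y
    simp only [Pi.smul_apply, smul_eq_mul, mul_pow, Finset.mul_sum]
  · intro c y
    simp only [Fin.sum_univ_succ, Fin.cons_zero, Fin.cons_succ, Pi.smul_apply, smul_eq_mul,
      Finset.mul_sum, mul_add]
    refine Finset.sum_congr rfl fun i _ => ?_
    refine congrArg₂ _ (by ring) (Finset.sum_congr rfl fun j _ => by ring)
  · intro y hy
    have hform : ∑ i : Fin N, y i * ∑ j : Fin (N + 1),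
          G.a i.succ j * (y i - (Fin.cons 0 y : Fin (N + 1) → ℝ) j) =
        ∑ i : Fin N, G.a i.succ 0 * y i ^ 2 +
          1 / 2 * ∑ i : Fin N, ∑ j : Fin N, G.a i.succ j.succ * (y i - y j) ^ 2 := by
      have hswap : ∑ i : Fin N, ∑ j : Fin N, G.a i.succ j.succ * (y i * (y i - y j)) =
          ∑ i : Fin N, ∑ j : Fin N, G.a i.succ j.succ * (y j * (y j - y i)) := by
        rw [Finset.sum_comm]
        exact Finset.sum_congr rfl fun i _ => Finset.sum_congr rfl fun j _ => by rw [hsym]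
      have hsum : ∑ i : Fin N, ∑ j : Fin N, G.a i.succ j.succ * (y i - y j) ^ 2 =
          ∑ i : Fin N, ∑ j : Fin N, G.a i.succ j.succ * (y i * (y i - y j)) +
          ∑ i : Fin N, ∑ j : Fin N, G.a i.succ j.succ * (y j * (y j - y i)) := by
        simp only [← Finset.sum_add_distrib]
        exact Finset.sum_congr rfl fun i _ => Finset.sum_congr rfl fun j _ => by ring
      rw [hsum, ← hswap, ← two_mul, ← mul_assoc, one_div, inv_mul_cancel₀ two_ne_zero, one_mul,
        ← Finset.sum_add_distrib]
      refine Finset.sum_congr rfl fun i _ => ?_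
      rw [Fin.sum_univ_succ, mul_add, Finset.mul_sum]
      simp only [Fin.cons_zero, Fin.cons_succ]
      refine congrArg₂ _ (by ring) (Finset.sum_congr rfl fun j _ => by ring)
    rw [hform]
    have hn1 : ∀ i ∈ Finset.univ, 0 ≤ G.a i.succ 0 * y i ^ 2 := fun i _ =>
      mul_nonneg (G.nonneg _ _) (sq_nonneg _)
    have hn2 : ∀ i : Fin N, ∀ j ∈ Finset.univ, 0 ≤ G.a i.succ j.succ * (y i - y j) ^ 2 :=
      fun i j _ => mul_nonneg (G.nonneg _ _) (sq_nonneg _)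
    have hn3 : ∀ i ∈ Finset.univ, 0 ≤ ∑ j : Fin N, G.a i.succ j.succ * (y i - y j) ^ 2 :=
      fun i _ => Finset.sum_nonneg (hn2 i)
    have hs1 := Finset.sum_nonneg hn1
    have hs2 := Finset.sum_nonneg hn3
    refine lt_of_le_of_ne (by positivity) fun h0 => hy ?_
    have hz1 := (Finset.sum_eq_zero_iff_of_nonneg hn1).1 (by linarith)
    have hz2 := (Finset.sum_eq_zero_iff_of_nonneg hn3).1 (by linarith)
    -- If the form vanishes, the value `0` of the leader propagates along the paths of the graph.
    have hall : ∀ l : Fin (N + 1), (Fin.cons 0 y : Fin (N + 1) → ℝ) l = 0 := by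
      intro l
      induction hpath l with
      | refl => rfl
      | @tail b c _ hbc ih =>
        cases c using Fin.cases with
        | zero => rfl
        | succ i =>
          cases b using Fin.cases with
          | zero => simpa [hbc.ne'] using hz1 i (Finset.mem_univ i)
          | succ j =>
            have h := (Finset.sum_eq_zero_iff_of_nonneg (hn2 i)).1 (hz2 i (Finset.mem_univ i)) j
              (Finset.mem_univ j)
            simp only [Fin.cons_succ] at ih ⊢
            simpa [hbc.ne', ih] using h
    funext i
    simpa using hall i.succ

/-! ### Companion matrices and block triangular matrices -/

open Polynomial in
/-- If the coordinates `f 0, …, f (d - 1)` form a chain of integrators under `T` that ends with the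
feedback of the coefficients of `p` and the input `err`, then the first coordinate of `p(T) z` is
`err z`. -/
theorem aeval_mulVec_chain {J : Type*} [Fintype J] [DecidableEq J] (T : Matrix J J ℝ) {p : ℝ[X]}
    (hp : p.Monic) {d : ℕ} (hd : p.natDegree = d) (f : Fin d → J) (err : (J → ℝ) → ℝ)
    (hstep : ∀ z (j : Fin d) (hj : (j : ℕ) + 1 < d), (T *ᵥ z) (f j) = z (f ⟨j + 1, hj⟩))
    (hlast : ∀ z (j : Fin d), (j : ℕ) + 1 = d →
      (T *ᵥ z) (f j) = err z - ∑ k : Fin d, p.coeff k * z (f k))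
    (z : J → ℝ) (hpos : 0 < d) : (aeval T p *ᵥ z) (f ⟨0, hpos⟩) = err z := by
  have hpow : ∀ (j : ℕ) (hj : j < d) z, (T ^ j *ᵥ z) (f ⟨0, hpos⟩) = z (f ⟨j, hj⟩) := by
    intro j
    induction j with
    | zero => intro hj z; simp
    | succ j ih =>
      intro hj z
      rw [pow_succ, ← Matrix.mulVec_mulVec, ih (by omega), hstep z ⟨j, by omega⟩ hj]
  obtain ⟨e, rfl⟩ : ∃ e, d = e + 1 := ⟨d - 1, by omega⟩
  have hlead : p.coeff (e + 1) = 1 := hd ▸ hp.coeff_natDegree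
  have htop : (T ^ (e + 1) *ᵥ z) (f ⟨0, hpos⟩) =
      err z - ∑ k : Fin (e + 1), p.coeff k * z (f k) := by
    rw [pow_succ, ← Matrix.mulVec_mulVec, hpow e (by omega), hlast z ⟨e, by omega⟩ rfl]
  have hsum : (aeval T p *ᵥ z) (f ⟨0, hpos⟩) =
      ∑ k ∈ Finset.range (e + 1 + 1), p.coeff k * (T ^ k *ᵥ z) (f ⟨0, hpos⟩) := by
    rw [aeval_eq_sum_range, hd, Matrix.sum_mulVec, Finset.sum_apply]
    exact Finset.sum_congr rfl fun k _ => by rw [Matrix.smul_mulVec]; rfl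
  rw [hsum, Finset.sum_range_succ, htop, hlead, Finset.sum_range]
  have : ∀ k : Fin (e + 1), (T ^ (k : ℕ) *ᵥ z) (f ⟨0, hpos⟩) = z (f k) := fun k => hpow k k.2 z
  simp only [this]
  ring

open Polynomial in
theorem exists_aeval_fromBlocks {ι κ : Type*} [Fintype ι] [Fintype κ] [DecidableEq ι]
    [DecidableEq κ] (A : Matrix ι ι ℝ) (E : Matrix ι κ ℝ) (S : Matrix κ κ ℝ) (p : ℝ[X]) :
    ∃ Y : Matrix ι κ ℝ, aeval (Matrix.fromBlocks A E 0 S) p =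
      Matrix.fromBlocks (aeval A p) Y 0 (aeval S p) := by
  induction p using Polynomial.induction_on' with
  | add p r hp hr =>
    obtain ⟨Y, hY⟩ := hp
    obtain ⟨Z, hZ⟩ := hr
    exact ⟨Y + Z, by simp [hY, hZ, Matrix.fromBlocks_add]⟩
  | monomial k c =>
    suffices h : ∃ Y : Matrix ι κ ℝ, (Matrix.fromBlocks A E 0 S) ^ k =
        Matrix.fromBlocks (A ^ k) Y 0 (S ^ k) by
      obtain ⟨Y, hY⟩ := h
      refine ⟨c • Y, ?_⟩
      simp only [aeval_monomial, hY, Algebra.algebraMap_eq_smul_one, smul_mul_assoc, one_mul,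
        Matrix.fromBlocks_smul, smul_zero]
    induction k with
    | zero => exact ⟨0, by simp⟩
    | succ k ih =>
      obtain ⟨Y, hY⟩ := ih
      exact ⟨A ^ k * E + Y * S, by rw [pow_succ, hY, Matrix.fromBlocks_multiply]; simp [pow_succ]⟩

open Polynomial in
/-- Left eigenvectors of a companion matrix, written in coordinates: the last entry `g` determines
the vector, and if `g` is nonzero the eigenvalue `l` is a root of `p`. For `d = 0` there is no last
entry, and `g` is unconstrained. -/
theorem companion_left_eigenvector {p : ℝ[X]} (hp : p.Monic) {d : ℕ} (hd : p.natDegree = d)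
    (b : Fin d → ℂ) (l g : ℂ) (hg : ∀ j : Fin d, (j : ℕ) + 1 = d → b j = g)
    (hb : ∀ j : Fin d, (∑ i : Fin d, if (i : ℕ) + 1 = j then b i else 0) - p.coeff j * g =
      l * b j) : (g = 0 → b = 0) ∧ (d = 0 ∨ aeval l p * g = 0) := by
  have h0 : ∀ hd0 : 0 < d, l * b ⟨0, hd0⟩ = -(p.coeff 0 * g) := fun hd0 => by
    have := hb ⟨0, hd0⟩
    simpa using this.symm
  have hs : ∀ j (hj : j + 1 < d), l * b ⟨j + 1, hj⟩ = b ⟨j, by omega⟩ - p.coeff (j + 1) * g := by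
    intro j hj
    have := hb ⟨j + 1, hj⟩
    rw [Finset.sum_eq_single ⟨j, by omega⟩] at this
    · simpa using this.symm
    · intro i _ hi
      rw [if_neg]
      intro h
      exact hi (Fin.ext (by simpa using h))
    · simp
  constructor
  · rintro rfl
    have : ∀ k j (hj : j < d), j + 1 + k = d → b ⟨j, hj⟩ = 0 := by
      intro k
      induction k with
      | zero => intro j hj h; exact hg ⟨j, hj⟩ h
      | succ k ih =>
        intro j hj h
        have h1 := hs j (by omega)
        rw [ih (j + 1) (by omega) (by omega)] at h1
        simpa using h1.symm
    funext j
    exact this (d - 1 - j) j j.2 (by omega)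
  · rcases Nat.eq_zero_or_pos d with h | hpos
    · exact Or.inl h
    refine Or.inr ?_
    -- Horner's scheme, from the constant coefficient upwards.
    have hH : ∀ j (hj : j < d), l ^ (j + 1) * b ⟨j, hj⟩ =
        -(∑ i ∈ Finset.range (j + 1), p.coeff i * l ^ i) * g := by
      intro j
      induction j with
      | zero => intro hj; simpa using h0 hj
      | succ j ih =>
        intro hj
        rw [Finset.sum_range_succ, pow_succ, mul_assoc, hs j hj, mul_sub, ih (by omega)]
        ring
    obtain ⟨e, rfl⟩ : ∃ e, d = e + 1 := ⟨d - 1, by omega⟩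
    have h1 := hH e (by omega)
    rw [hg ⟨e, by omega⟩ rfl] at h1
    have hlead : p.coeff (e + 1) = 1 := hd ▸ hp.coeff_natDegree
    have h2 : aeval l p = ∑ i ∈ Finset.range (e + 1), (p.coeff i : ℂ) * l ^ i + l ^ (e + 1) := by
      rw [aeval_eq_sum_range, hd, Finset.sum_range_succ, hlead, one_smul]
      simp only [Complex.real_smul]
    rw [h2, add_mul, h1]
    ring

theorem Matrix.vecMul_eq_zero_of_rank_eq_card {ι κ : Type*} [Fintype ι] [Fintype κ] {K : Type*}
    [Field K] (R : Matrix ι κ K) (h : R.rank = Fintype.card ι) {x : ι → K} (hx : x ᵥ* R = 0) :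
    x = 0 := by
  have h1 : LinearIndependent K R.row := by
    rw [linearIndependent_iff_card_eq_finrank_span, ← h, Matrix.rank_eq_finrank_span_row]
    rfl
  exact Matrix.vecMul_injective_iff.2 h1 (by simpa using hx)

theorem hasEigenvalue_of_aeval_minpoly_eq_zero {m : ℕ} (S : Matrix (Fin m) (Fin m) ℝ) {l : ℂ}
    (hl : Polynomial.aeval l (minpoly ℝ S) = 0) :
    Module.End.HasEigenvalue (Matrix.toLin' (S.map (algebraMap ℝ ℂ))) l := by
  rw [Module.End.hasEigenvalue_iff_isRoot_charpoly, Matrix.charpoly_toLin', Matrix.charpoly_map]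
  obtain ⟨r, hr⟩ := Matrix.minpoly_dvd_charpoly S
  rw [Polynomial.IsRoot, Polynomial.eval_map_algebraMap, hr, map_mul, hl, zero_mul]

/-! ### Controllability of the augmented plant -/

namespace ConsensusTracking

/-- For a controllable pair no complex left eigenvector of `A` is annihilated by `B`. -/
theorem Controllable.eq_zero {n p : ℕ} {A : Matrix (Fin n) (Fin n) ℝ} {B : Matrix (Fin n) (Fin p) ℝ}
    (h : Controllable A B) {a : Fin n → ℂ} {l : ℂ}
    (hA : a ᵥ* A.map (algebraMap ℝ ℂ) = l • a) (hB : a ᵥ* B.map (algebraMap ℝ ℂ) = 0) :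
    a = 0 := by
  have hpow : ∀ k : ℕ, a ᵥ* (A ^ k * B).map (algebraMap ℝ ℂ) = 0 := by
    intro k
    have hk : a ᵥ* (A ^ k).map (algebraMap ℝ ℂ) = l ^ k • a := by
      induction k with
      | zero => simp [Matrix.map_one]
      | succ k ih =>
        rw [pow_succ, Matrix.map_mul, ← Matrix.vecMul_vecMul, ih, Matrix.smul_vecMul, hA,
          smul_smul, pow_succ]
    rw [Matrix.map_mul, ← Matrix.vecMul_vecMul, hk, Matrix.smul_vecMul, hB, smul_zero]
  have hre : ∀ f : ℂ →ₗ[ℝ] ℝ, (fun i => f (a i)) = 0 := by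
    intro f
    -- `f` is the real or the imaginary part, which both lie in the left kernel of a real matrix.
    refine Matrix.vecMul_eq_zero_of_rank_eq_card _ (h.trans (Fintype.card_fin n).symm) ?_
    funext kj
    have h1 := congrArg f (congrFun (hpow kj.1) kj.2)
    simp only [Matrix.vecMul, dotProduct, Matrix.map_apply, map_sum, Pi.zero_apply, map_zero,
      Complex.coe_algebraMap, mul_comm (a _), ← Complex.real_smul, map_smul, smul_eq_mul] at h1
    simpa only [Matrix.vecMul, dotProduct, Matrix.of_apply, Pi.zero_apply, mul_comm] using h1
  funext i
  exact Complex.ext (congrFun (hre Complex.reLm) i) (congrFun (hre Complex.imLm) i)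

theorem Observable.eq_zero {n q : ℕ} {C : Matrix (Fin q) (Fin n) ℝ} {A : Matrix (Fin n) (Fin n) ℝ}
    (h : Observable C A) {x : Fin n → ℝ} (hx : ∀ k : ℕ, C *ᵥ (A ^ k *ᵥ x) = 0) : x = 0 := by
  unfold Observable at h
  rw [← Matrix.rank_transpose] at h
  refine Matrix.vecMul_eq_zero_of_rank_eq_card _ (h.trans (Fintype.card_fin n).symm) ?_
  rw [Matrix.vecMul_transpose]
  funext ki
  have h1 := congrFun (hx ki.1) ki.2
  rw [Matrix.mulVec_mulVec] at h1
  exact h1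

namespace MultiAgentSystem

variable {N q m : ℕ} (M : MultiAgentSystem N q m)

/-- The index set of the joint state of a follower and its internal model. -/
abbrev AugIdx (i : Fin N) : Type := Fin (M.n i) ⊕ Fin q × Fin M.pm

/-- State matrix of follower `i` in series with its internal model, before feedback. -/
noncomputable def augA (w : M.Uncertainty) (i : Fin N) : Matrix (M.AugIdx i) (M.AugIdx i) ℝ :=
  Matrix.fromBlocks (M.Aw w i) 0 (M.G₂ * M.Cw w i) M.G₁

/-- Input matrix of follower `i` in series with its internal model. -/
noncomputable def augB (w : M.Uncertainty) (i : Fin N) : Matrix (M.AugIdx i) (Fin (M.p i)) ℝ :=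
  Matrix.fromRows (M.Bw w i) (M.G₂ * M.Dw w i)

/-- The matrix through which the estimate `η i` of the leader state enters the joint dynamics. -/
noncomputable def augE (i : Fin N) : Matrix (M.AugIdx i) (Fin m) ℝ :=
  Matrix.fromRows 0 (M.G₂ * M.F)

theorem minpoly_monic : (minpoly ℝ M.S).Monic :=
  minpoly.monic (Matrix.isIntegral M.S)

theorem G₂_mul_apply {α : Type*} (R : Matrix (Fin q) α ℝ) (k : Fin q) (s : Fin M.pm) (j : α) :
    (M.G₂ * R) (k, s) j = M.γ s * R k j := by
  simp [G₂, Matrix.mul_apply, Matrix.one_apply]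

/-- The nominal augmented pair is controllable. A left eigenvector `(a, b)` for `l` annihilated by the
input matrix gives a left null vector `(a, g)` of the transmission zero matrix at `l`, where `g`
collects the last entries of the blocks of `b`. If `g ≠ 0` then `l` is an eigenvalue of `S`, against
the rank condition; if `g = 0` then `b = 0`, and `a = 0` by controllability of the follower. -/
theorem augmented_controllable {i : Fin N} (hc : Controllable (M.A i) (M.B i))
    (ht : M.TransmissionZeroCondition) (y : M.AugIdx i → ℝ)
    (hy : ∀ k : ℕ, (M.augB 0 i)ᵀ *ᵥ ((M.augA 0 i)ᵀ ^ k *ᵥ y) = 0) : y = 0 := by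
  refine observable_of_forall_eigenvector _ _ (fun l z h1 h2 => ?_) y hy
  have hA0 : M.Aw 0 i = M.A i := by ext; simp [Aw, Matrix.toBlocks₁₁]
  have hB0 : M.Bw 0 i = M.B i := by ext; simp [Bw, Matrix.toBlocks₁₂]
  have hC0 : M.Cw 0 i = M.C i := by ext; simp [Cw, Matrix.toBlocks₂₁]
  have hD0 : M.Dw 0 i = M.D i := by ext; simp [Dw, Matrix.toBlocks₂₂]
  set a : Fin (M.n i) → ℂ := fun j => z (Sum.inl j) with ha
  set b : Fin q → Fin M.pm → ℂ := fun k s => z (Sum.inr (k, s)) with hb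
  set g : Fin q → ℂ := fun k => ∑ s, (M.γ s : ℂ) * b k s with hg
  have hrowA : ∀ j, ∑ r, a r * (M.A i r j : ℂ) + ∑ k, g k * (M.C i k j : ℂ) = l * a j := by
    intro j
    have := congrFun h1 (Sum.inl j)
    simp [Matrix.mulVec, dotProduct, augA, G₂_mul_apply, Fintype.sum_prod_type, hA0, hC0] at this
    rw [ha, ← this]
    simp only [hg, Finset.sum_mul]
    refine congrArg₂ _ (Finset.sum_congr rfl fun r _ => by ring)
      (Finset.sum_congr rfl fun k _ => Finset.sum_congr rfl fun s _ => by ring)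
  have hrowB : ∀ j, ∑ r, a r * (M.B i r j : ℂ) + ∑ k, g k * (M.D i k j : ℂ) = 0 := by
    intro j
    have := congrFun h2 j
    simp [Matrix.mulVec, dotProduct, augB, G₂_mul_apply, Fintype.sum_prod_type, hB0, hD0] at this
    rw [ha, ← this]
    simp only [hg, Finset.sum_mul]
    refine congrArg₂ _ (Finset.sum_congr rfl fun r _ => by ring)
      (Finset.sum_congr rfl fun k _ => Finset.sum_congr rfl fun s _ => by ring)
  have hcol : ∀ k (s : Fin M.pm),
      (∑ r : Fin M.pm, if (r : ℕ) + 1 = s then b k r else 0) -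
        (minpoly ℝ M.S).coeff s * g k = l * b k s := by
    intro k s
    have := congrFun h1 (Sum.inr (k, s))
    simp [Matrix.mulVec, dotProduct, augA, G₁, Fintype.sum_prod_type, Matrix.one_apply, β,
      Matrix.kroneckerMap_apply] at this
    rw [hb, ← this]
    simp only [hg, γ, Finset.mul_sum, ← Finset.sum_sub_distrib]
    rw [Finset.sum_eq_single k (fun r _ hr => by simp [hr]) (by simp)]
    refine Finset.sum_congr rfl fun r _ => ?_
    rw [if_pos rfl]
    split_ifs <;> simp [hb, sub_mul]
  have hlast : ∀ k (s : Fin M.pm), (s : ℕ) + 1 = M.pm → b k s = g k := by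
    intro k s hs
    have hγ : ∀ r ≠ s, M.γ r = 0 := fun r hr => if_neg fun h => hr (Fin.ext (by omega))
    simp only [hg]
    rw [Finset.sum_eq_single s (fun r _ hr => by simp [hγ r hr]) (by simp)]
    simp [γ, hs]
  have hcomp := fun k => companion_left_eigenvector M.minpoly_monic rfl (b k) l (g k)
    (hlast k) (hcol k)
  have hg0 : g = 0 := by
    by_contra hne
    obtain ⟨k, hk⟩ := Function.ne_iff.1 hne
    have hroot : Polynomial.aeval l (minpoly ℝ M.S) = 0 := by
      rcases (hcomp k).2 with h | h
      · refine absurd ?_ hk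
        have : IsEmpty (Fin M.pm) := by
          unfold pm; rw [h]; infer_instance
        simp [hg]
      · exact (mul_eq_zero.1 h).resolve_right hk
    have hrank := ht i l (hasEigenvalue_of_aeval_minpoly_eq_zero M.S hroot)
    have hz := Matrix.vecMul_eq_zero_of_rank_eq_card _ (hrank.trans (by simp))
      (x := Sum.elim a g) (by
        funext j
        rcases j with j | j
        · have := hrowA j
          simp [Matrix.vecMul, dotProduct, Matrix.one_apply, mul_sub, Finset.sum_sub_distrib]
          linear_combination this
        · simpa [Matrix.vecMul, dotProduct] using hrowB j)
    exact hk (congrFun hz (Sum.inr k))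
  have hb0 : ∀ k s, b k s = 0 := fun k s => by
    rw [(hcomp k).1 (congrFun hg0 k)]; rfl
  have ha0 : a = 0 := by
    refine hc.eq_zero (l := l) ?_ ?_
    · funext j; simpa [Matrix.vecMul, dotProduct, hg0] using hrowA j
    · funext j; simpa [Matrix.vecMul, dotProduct, hg0] using hrowB j
  funext j
  rcases j with j | ⟨k, s⟩
  · exact congrFun ha0 j
  · exact hb0 k s

end MultiAgentSystem

/-! ### The distributed observer -/

/-- A gain `L` for the distributed observer whose error has the same quadratic Lyapunov function in
all the graphs. If `Q S + Sᵀ Q ≤ Fᵀ F - 2 Q` and `L = μ Q⁻¹ Fᵀ`, the coupling contributes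
`-2 μ` times the graph form of the outputs `F ε i`, which dominates `Fᵀ F` for large `μ`. -/
theorem exists_observer_gain {N q m κ : ℕ} {S : Matrix (Fin m) (Fin m) ℝ}
    {F : Matrix (Fin q) (Fin m) ℝ} (hobs : Observable F S) {G : Fin κ → CommGraph N}
    (hG : ∀ r, (G r).Connected) :
    ∃ (L : Matrix (Fin m) (Fin q) ℝ) (Q : Matrix (Fin m) (Fin m) ℝ), Q.PosDef ∧
      ∀ (r : Fin κ) (ε : Fin N → Fin m → ℝ),
        ∑ i, 2 * (ε i ⬝ᵥ Q *ᵥ (S *ᵥ ε i - L *ᵥ (F *ᵥ ∑ j : Fin (N + 1), (G r).a i.succ j •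
          (ε i - (Fin.cons 0 ε : Fin (N + 1) → Fin m → ℝ) j)))) ≤
        -2 * ∑ i, ε i ⬝ᵥ Q *ᵥ ε i := by
  obtain ⟨Q, hQ, hle⟩ := exists_posDef_of_observable S F fun x hx => hobs.eq_zero hx
  choose k hk0 hk using fun r => (hG r).exists_coercive
  have hu : IsUnit Q.det := (Matrix.isUnit_iff_isUnit_det _).1 hQ.isUnit
  refine ⟨((∑ r, k r) / 2) • (Q⁻¹ * Fᵀ), Q, hQ, fun r ε => ?_⟩
  set h : Fin N → Fin m → ℝ := fun i => ∑ j : Fin (N + 1), (G r).a i.succ j •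
          (ε i - (Fin.cons 0 ε : Fin (N + 1) → Fin m → ℝ) j) with hh
  -- In output coordinates the coupling is one copy of the graph operator for each output.
  have hcoord : ∀ i c, (F *ᵥ h i) c = ∑ j : Fin (N + 1), (G r).a i.succ j *
      ((F *ᵥ ε i) c - (Fin.cons 0 (fun i => (F *ᵥ ε i) c) : Fin (N + 1) → ℝ) j) := by
    intro i c
    simp only [hh, Matrix.mulVec_sum, Finset.sum_apply, Matrix.mulVec_smul, Pi.smul_apply,
      smul_eq_mul, Matrix.mulVec_sub, Pi.sub_apply]
    refine Finset.sum_congr rfl fun j _ => ?_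
    cases j using Fin.cases <;> simp
  have hcoer : ∑ i, (F *ᵥ ε i) ⬝ᵥ (F *ᵥ ε i) ≤ (∑ r, k r) * ∑ i, (F *ᵥ ε i) ⬝ᵥ (F *ᵥ h i) := by
    simp only [dotProduct]
    rw [Finset.sum_comm, Finset.sum_comm (f := fun i c => (F *ᵥ ε i) c * (F *ᵥ h i) c),
      Finset.mul_sum]
    refine Finset.sum_le_sum fun c _ => ?_
    have h1 := hk r fun i => (F *ᵥ ε i) c
    simp only [hcoord, ← sq]
    refine h1.trans (mul_le_mul_of_nonneg_right
      (Finset.single_le_sum (fun r _ => (hk0 r).le) (Finset.mem_univ r)) ?_)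
    exact (mul_nonneg_iff_of_pos_left (hk0 r)).1
      ((Finset.sum_nonneg fun _ _ => sq_nonneg _).trans h1)
  have hterm : ∀ i, 2 * (ε i ⬝ᵥ Q *ᵥ (S *ᵥ ε i - (((∑ r, k r) / 2) • (Q⁻¹ * Fᵀ)) *ᵥ (F *ᵥ h i))) ≤
      (F *ᵥ ε i) ⬝ᵥ (F *ᵥ ε i) - 2 * (ε i ⬝ᵥ Q *ᵥ ε i) -
        (∑ r, k r) * ((F *ᵥ ε i) ⬝ᵥ (F *ᵥ h i)) := by
    intro i
    have h1 : Q *ᵥ ((((∑ r, k r) / 2) • (Q⁻¹ * Fᵀ)) *ᵥ (F *ᵥ h i)) =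
        ((∑ r, k r) / 2) • (Fᵀ *ᵥ (F *ᵥ h i)) := by
      rw [Matrix.smul_mulVec, Matrix.mulVec_smul, ← Matrix.mulVec_mulVec,
        Matrix.mulVec_mulVec _ Q, Matrix.mul_nonsing_inv _ hu, Matrix.one_mulVec]
    have h2 : ε i ⬝ᵥ Fᵀ *ᵥ (F *ᵥ h i) = (F *ᵥ ε i) ⬝ᵥ (F *ᵥ h i) := by
      rw [Matrix.dotProduct_mulVec, Matrix.vecMul_transpose]
    rw [Matrix.mulVec_sub, dotProduct_sub, h1, dotProduct_smul, h2, smul_eq_mul]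
    linarith [hle (ε i)]
  refine (Finset.sum_le_sum fun i _ => hterm i).trans ?_
  rw [Finset.sum_sub_distrib, Finset.sum_sub_distrib, ← Finset.mul_sum, ← Finset.mul_sum]
  linarith

/-! ### The closed loop and the internal model principle -/

namespace MultiAgentSystem

variable {N q m : ℕ} (M : MultiAgentSystem N q m)

/-- Closed-loop matrix of the joint state of follower `i` under the feedback `u i = K (x i, ξ i)`. -/
noncomputable def closedA (w : M.Uncertainty) (i : Fin N)
    (K : Matrix (Fin (M.p i)) (M.AugIdx i) ℝ) :
    Matrix (M.AugIdx i) (M.AugIdx i) ℝ :=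
  M.augA w i + M.augB w i * K

/-- Output matrix of follower `i` in terms of its joint state, under the same feedback. -/
noncomputable def closedC (w : M.Uncertainty) (i : Fin N)
    (K : Matrix (Fin (M.p i)) (M.AugIdx i) ℝ) :
    Matrix (Fin q) (M.AugIdx i) ℝ :=
  Matrix.fromCols (M.Cw w i) 0 + M.Dw w i * K

theorem continuous_closedA (i : Fin N) (K : Matrix (Fin (M.p i)) (M.AugIdx i) ℝ) :
    Continuous fun w => M.closedA w i K := by
  have hA : Continuous fun w => M.Aw w i := continuous_const.add
    (continuous_matrix fun r s => by simp only [Matrix.toBlocks₁₁, Matrix.of_apply]; fun_prop)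
  have hB : Continuous fun w => M.Bw w i := continuous_const.add
    (continuous_matrix fun r s => by simp only [Matrix.toBlocks₁₂, Matrix.of_apply]; fun_prop)
  have hC : Continuous fun w => M.Cw w i := continuous_const.add
    (continuous_matrix fun r s => by simp only [Matrix.toBlocks₂₁, Matrix.of_apply]; fun_prop)
  have hD : Continuous fun w => M.Dw w i := continuous_const.add
    (continuous_matrix fun r s => by simp only [Matrix.toBlocks₂₂, Matrix.of_apply]; fun_prop)
  refine (hA.matrix_fromBlocks continuous_const (continuous_const.matrix_mul hC)
    continuous_const).add (Continuous.matrix_mul ?_ continuous_const)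
  refine continuous_matrix fun r s => ?_
  rcases r with r | r
  · exact hB.matrix_elem r s
  · exact (continuous_const.matrix_mul hD).matrix_elem r s

/-- Robustness: half of the nominal decay rate survives small perturbations of the plant. -/
theorem eventually_decay {i : Fin N} {K : Matrix (Fin (M.p i)) (M.AugIdx i) ℝ}
    {P : Matrix (M.AugIdx i) (M.AugIdx i) ℝ} (hP : P.PosDef)
    (h : ∀ z, 2 * (z ⬝ᵥ P *ᵥ (M.closedA 0 i K *ᵥ z)) ≤ -2 * (z ⬝ᵥ P *ᵥ z)) :
    ∀ᶠ w in 𝓝 (0 : M.Uncertainty), ∀ z,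
      2 * (z ⬝ᵥ P *ᵥ (M.closedA w i K *ᵥ z)) ≤ -(z ⬝ᵥ P *ᵥ z) := by
  have hcont : Continuous fun wz : M.Uncertainty × (M.AugIdx i → ℝ) =>
      2 * (wz.2 ⬝ᵥ P *ᵥ (M.closedA wz.1 i K *ᵥ wz.2)) :=
    continuous_const.mul (continuous_snd.dotProduct (continuous_const.matrix_mulVec
      (((M.continuous_closedA i K).comp continuous_fst).matrix_mulVec continuous_snd)))
  have hev := (isCompact_sphere (0 : M.AugIdx i → ℝ) 1).eventually_forall_of_forall_eventually
    (x₀ := (0 : M.Uncertainty)) (P := fun w z =>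
      2 * (z ⬝ᵥ P *ᵥ (M.closedA w i K *ᵥ z)) < -(z ⬝ᵥ P *ᵥ z)) (fun z hz => by
        refine (hcont.continuousAt.eventually_lt (f := fun wz : M.Uncertainty × (M.AugIdx i → ℝ) =>
          2 * (wz.2 ⬝ᵥ P *ᵥ (M.closedA wz.1 i K *ᵥ wz.2)))
          (g := fun wz => -(wz.2 ⬝ᵥ P *ᵥ wz.2)) (by fun_prop) ?_)
        have hz0 : z ≠ 0 := fun h => by simp [h] at hz
        have := hP.quadForm_pos hz0
        have := h z
        simp only
        linarith)
  filter_upwards [hev] with w hw z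
  by_cases hz : z = 0
  · simp [hz]
  have hn : ‖z‖ ≠ 0 := norm_ne_zero_iff.2 hz
  have h1 := (hw (‖z‖⁻¹ • z) (by simp [norm_smul, hn])).le
  rw [Matrix.mulVec_mulVec, quadForm_smul, quadForm_smul, ← Matrix.mulVec_mulVec] at h1
  have h2 : 0 < ‖z‖⁻¹ ^ 2 := by positivity
  nlinarith

theorem G₁_mulVec (ξ : Fin q × Fin M.pm → ℝ) (k : Fin q) (s : Fin M.pm) :
    (M.G₁ *ᵥ ξ) (k, s) = (M.β *ᵥ fun r => ξ (k, r)) s := by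
  simp [G₁, Matrix.mulVec, dotProduct, Fintype.sum_prod_type, Matrix.kroneckerMap_apply,
    Matrix.one_apply]

theorem G₂_mulVec (r : Fin q → ℝ) (k : Fin q) (s : Fin M.pm) :
    (M.G₂ *ᵥ r) (k, s) = M.γ s * r k := by
  simp [G₂, Matrix.mulVec, dotProduct, Matrix.one_apply]

theorem closedC_mulVec (w : M.Uncertainty) (i : Fin N)
    (K : Matrix (Fin (M.p i)) (M.AugIdx i) ℝ) (z : M.AugIdx i → ℝ) :
    M.closedC w i K *ᵥ z = M.Cw w i *ᵥ (z ∘ Sum.inl) + M.Dw w i *ᵥ (K *ᵥ z) := by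
  rw [closedC, Matrix.add_mulVec, Matrix.mulVec_mulVec, Matrix.fromCols_mulVec, Matrix.zero_mulVec,
    add_zero]

theorem closedA_mulVec_inl (w : M.Uncertainty) (i : Fin N)
    (K : Matrix (Fin (M.p i)) (M.AugIdx i) ℝ) (z : M.AugIdx i → ℝ) (r : Fin (M.n i)) :
    (M.closedA w i K *ᵥ z) (Sum.inl r) =
      (M.Aw w i *ᵥ (z ∘ Sum.inl) + M.Bw w i *ᵥ (K *ᵥ z)) r := by
  rw [closedA, Matrix.add_mulVec, ← Matrix.mulVec_mulVec, augA, augB, Matrix.fromBlocks_mulVec,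
    Matrix.fromRows_mulVec]
  simp

theorem closedA_mulVec_inr (w : M.Uncertainty) (i : Fin N)
    (K : Matrix (Fin (M.p i)) (M.AugIdx i) ℝ) (z : M.AugIdx i → ℝ) (k : Fin q) (s : Fin M.pm) :
    (M.closedA w i K *ᵥ z) (Sum.inr (k, s)) =
      (M.β *ᵥ fun r => z (Sum.inr (k, r))) s + M.γ s * (M.closedC w i K *ᵥ z) k := by
  rw [closedC_mulVec, closedA, Matrix.add_mulVec, ← Matrix.mulVec_mulVec, augA, augB,
    Matrix.fromBlocks_mulVec, Matrix.fromRows_mulVec, ← Matrix.mulVec_mulVec,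
    ← Matrix.mulVec_mulVec]
  simp only [Pi.add_apply, Sum.elim_inr, G₂_mulVec, G₁_mulVec, mul_add, Function.comp_def]
  ring

/-- The internal model principle, without any Sylvester equation. Let `p` be the minimal polynomial of
`S`. Applying `p` to the matrix of the joint dynamics of `(z, v)` with exact leader information gives
a block row `(R, Y)`, since the block of `S` is annihilated. The combination `ρ = R z + Y v` satisfies
the closed-loop equation with no forcing by `v`, whatever `w` is, and the tracking error is a fixed
linear function of `ρ`: its components are the first entries of the chains in the internal model. -/
theorem exists_internal_model_error (w : M.Uncertainty) (i : Fin N)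
    (K : Matrix (Fin (M.p i)) (M.AugIdx i) ℝ) :
    ∃ R : Matrix (M.AugIdx i) (M.AugIdx i) ℝ, ∃ Y : Matrix (M.AugIdx i) (Fin m) ℝ,
      Commute R (M.closedA w i K) ∧ R * M.augE i + Y * M.S = M.closedA w i K * Y ∧
      ∃ T : Matrix (Fin q) (M.AugIdx i) ℝ, ∀ z v,
        M.closedC w i K *ᵥ z + M.F *ᵥ v = T *ᵥ (R *ᵥ z + Y *ᵥ v) := by
  set Ac := M.closedA w i K with hAc
  set p := minpoly ℝ M.S with hp
  obtain ⟨Y, hY⟩ := exists_aeval_fromBlocks Ac (M.augE i) M.S p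
  rw [hp, minpoly.aeval, ← hp] at hY
  refine ⟨Polynomial.aeval Ac p, Y, ?_, ?_, ?_⟩
  · simpa using Commute.map (Polynomial.commute_X p).symm (Polynomial.aeval Ac)
  · have h : Commute (Polynomial.aeval (Matrix.fromBlocks Ac (M.augE i) 0 M.S) p)
        (Matrix.fromBlocks Ac (M.augE i) 0 M.S) := by
      simpa using Commute.map (Polynomial.commute_X p).symm
        (Polynomial.aeval (Matrix.fromBlocks Ac (M.augE i) 0 M.S))
    rw [hY] at h
    have h1 := congrArg Matrix.toBlocks₁₂ h.eq
    rw [Matrix.fromBlocks_multiply, Matrix.fromBlocks_multiply] at h1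
    simpa using h1
  rcases Nat.eq_zero_or_pos M.pm with h0 | hpos
  · -- A minimal polynomial of degree `0` means that the leader has no state, and the internal
    -- model is empty.
    have hp1 : p = 1 := M.minpoly_monic.natDegree_eq_zero.1 h0
    have hm : IsEmpty (Fin m) := by
      by_contra hne
      rw [not_isEmpty_iff] at hne
      have h1 : Polynomial.aeval M.S p = 0 := minpoly.aeval ℝ M.S
      rw [hp1, map_one] at h1
      exact one_ne_zero h1
    refine ⟨M.closedC w i K, fun z v => ?_⟩
    rw [hp1, map_one, Matrix.one_mulVec, Subsingleton.elim v 0, Matrix.mulVec_zero,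
      Matrix.mulVec_zero, add_zero, add_zero]
  · refine ⟨Matrix.of fun k => Pi.single (Sum.inr (k, ⟨0, hpos⟩)) 1, fun z v => ?_⟩
    funext k
    have hchain := aeval_mulVec_chain (Matrix.fromBlocks Ac (M.augE i) 0 M.S) M.minpoly_monic
      (d := M.pm) rfl (fun s => Sum.inl (Sum.inr (k, s)))
      (fun ζ => (M.closedC w i K *ᵥ (ζ ∘ Sum.inl) + M.F *ᵥ (ζ ∘ Sum.inr)) k) ?_ ?_ (Sum.elim z v) hpos
    · rw [← hp, hY, Matrix.fromBlocks_mulVec] at hchain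
      simp only [Sum.elim_comp_inl, Sum.elim_comp_inr] at hchain
      rw [← hchain]
      change _ = (Pi.single (Sum.inr (k, ⟨0, hpos⟩)) 1 : M.AugIdx i → ℝ) ⬝ᵥ _
      rw [single_one_dotProduct]
      rfl
    all_goals
      intro ζ s hs
      have h1 : (Matrix.fromBlocks Ac (M.augE i) 0 M.S *ᵥ ζ) (Sum.inl (Sum.inr (k, s))) =
          (M.β *ᵥ fun r => ζ (Sum.inl (Sum.inr (k, r)))) s + M.γ s *
            (M.closedC w i K *ᵥ (ζ ∘ Sum.inl) + M.F *ᵥ (ζ ∘ Sum.inr)) k := by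
        rw [Matrix.fromBlocks_mulVec, Sum.elim_inl, Pi.add_apply, hAc, closedA_mulVec_inr, augE,
          Matrix.fromRows_mulVec, Sum.elim_inr, ← Matrix.mulVec_mulVec, G₂_mulVec, Pi.add_apply]
        simp only [Function.comp_apply]
        ring
      rw [h1]
      simp only [β, γ, Matrix.mulVec, dotProduct, Matrix.of_apply, sub_mul, ite_mul, one_mul,
        zero_mul, Finset.sum_sub_distrib]
    · rw [Finset.sum_eq_single ⟨s + 1, hs⟩]
      · simp [hs.ne]
      · intro r _ hr
        rw [if_neg]
        intro h
        exact hr (Fin.ext h.symm)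
      · simp
    · rw [Finset.sum_eq_zero]
      · simp [hs]; ring
      · intro r _
        rw [if_neg]
        have := r.2
        omega

end MultiAgentSystem

end ConsensusTracking

/-! ### Decay of the tracking errors -/

namespace ConsensusTracking.MultiAgentSystem

variable {N q m : ℕ} {M : MultiAgentSystem N q m}

/-- Joint state of follower `i` and its internal model. -/
def Signals.joint (z : M.Signals) (i : Fin N) (t : ℝ) : M.AugIdx i → ℝ :=
  Sum.elim (z.x i t) (z.ξ i t)

/-- The gains given by joint feedback matrices `K i = [K₁ i, K₂ i]` and an observer gain. -/
noncomputable def Gains.ofAug (K : ∀ i, Matrix (Fin (M.p i)) (M.AugIdx i) ℝ)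
    (L : Matrix (Fin m) (Fin q) ℝ) : M.Gains where
  K₁ i := (K i).toCols₁
  K₂ i := (K i).toCols₂
  L₀ := L

variable {K : ∀ i, Matrix (Fin (M.p i)) (M.AugIdx i) ℝ} {L : Matrix (Fin m) (Fin q) ℝ}

theorem Signals.u_ofAug (z : M.Signals) (i : Fin N) (t : ℝ) :
    z.u (Gains.ofAug K L) i t = K i *ᵥ z.joint i t := by
  conv_rhs => rw [← Matrix.fromCols_toCols (K i), Signals.joint, Matrix.fromCols_mulVec]
  rfl

theorem Signals.y_ofAug (z : M.Signals) (w : M.Uncertainty) (i : Fin N) (t : ℝ) :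
    z.y (Gains.ofAug K L) w i t = M.closedC w i (K i) *ᵥ z.joint i t := by
  rw [closedC_mulVec, ← Signals.u_ofAug (L := L)]
  rfl

theorem Signals.IsTrajectory.deriv_joint {κ : ℕ} {τ₀ : ℝ} {z : M.Signals} {w : M.Uncertainty}
    {G : Fin κ → CommGraph N} {s : SwitchingSignal κ τ₀}
    (hz : z.IsTrajectory (Gains.ofAug K L) w G s) (i : Fin N) (k : ℕ) {t : ℝ}
    (ht : t ∈ Set.Ico (s.t k) (s.t (k + 1))) :
    HasDerivWithinAt (z.joint i)
      (M.closedA w i (K i) *ᵥ z.joint i t + M.augE i *ᵥ z.η i t)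
      (Set.Ico (s.t k) (s.t (k + 1))) t := by
  rw [hasDerivWithinAt_pi]
  have hx := hasDerivWithinAt_pi.1 (hz.deriv_x i k t ht)
  have hξ := hasDerivWithinAt_pi.1 (hz.deriv_ξ i k t ht)
  rintro (r | ⟨c, r⟩)
  · refine (hx r).congr_deriv ?_
    simp only [Pi.add_apply, closedA_mulVec_inl, augE, Matrix.fromRows_mulVec, Signals.u_ofAug]
    simp [Signals.joint]
  · refine (hξ (c, r)).congr_deriv ?_
    rw [Pi.add_apply, Pi.add_apply, closedA_mulVec_inr, augE, Matrix.fromRows_mulVec,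
      Signals.y_ofAug, G₂_mulVec, G₁_mulVec, Sum.elim_inr, ← Matrix.mulVec_mulVec, G₂_mulVec,
      Pi.add_apply]
    simp only [Signals.joint, Sum.elim_inr]
    ring

/-- The observer errors `η i - v` satisfy the homogeneous observer equation, with the error of the
leader equal to `0`. -/
theorem Signals.IsTrajectory.deriv_observer {κ : ℕ} {τ₀ : ℝ} {z : M.Signals} {w : M.Uncertainty}
    {G : Fin κ → CommGraph N} {s : SwitchingSignal κ τ₀} {Γ : M.Gains}
    (hz : z.IsTrajectory Γ w G s) (i : Fin N) (k : ℕ) {t : ℝ}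
    (ht : t ∈ Set.Ico (s.t k) (s.t (k + 1))) :
    HasDerivWithinAt (fun t => z.η i t - z.v t)
      (M.S *ᵥ (z.η i t - z.v t) - Γ.L₀ *ᵥ (M.F *ᵥ ∑ j : Fin (N + 1), (G (s.σ t)).a i.succ j •
        ((z.η i t - z.v t) -
          (Fin.cons 0 (fun i => z.η i t - z.v t) : Fin (N + 1) → Fin m → ℝ) j)))
      (Set.Ico (s.t k) (s.t (k + 1))) t := by
  refine ((hz.deriv_η i k t ht).sub (hz.deriv_v k t ht)).congr_deriv ?_
  have h : z.ηv (G (s.σ t)) i t = ∑ j : Fin (N + 1), (G (s.σ t)).a i.succ j •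
        ((z.η i t - z.v t) -
          (Fin.cons 0 (fun i => z.η i t - z.v t) : Fin (N + 1) → Fin m → ℝ) j) := by
    rw [Signals.ηv]
    refine Finset.sum_congr rfl fun j _ => ?_
    cases j using Fin.cases <;> simp [Signals.ηAll]
  rw [← h, Matrix.mulVec_sub]
  abel

/-- The Lyapunov function is `ρᵀ P ρ + 2 c ∑ ε jᵀ Q ε j`, with `ρ` the internal model combination of
`exists_internal_model_error` and `ε` the observer errors. It is the same quadratic form in every
graph, so switching does no harm. -/
theorem tendsto_error {κ : ℕ} {G : Fin κ → CommGraph N} {Q : Matrix (Fin m) (Fin m) ℝ}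
    (hQ : Q.PosDef) (hL : ∀ (r : Fin κ) (ε : Fin N → Fin m → ℝ),
        ∑ i, 2 * (ε i ⬝ᵥ Q *ᵥ (M.S *ᵥ ε i - L *ᵥ (M.F *ᵥ ∑ j : Fin (N + 1), (G r).a i.succ j •
          (ε i - (Fin.cons 0 ε : Fin (N + 1) → Fin m → ℝ) j)))) ≤
        -2 * ∑ i, ε i ⬝ᵥ Q *ᵥ ε i)
    {i : Fin N} {P : Matrix (M.AugIdx i) (M.AugIdx i) ℝ} (hP : P.PosDef) {w : M.Uncertainty}
    (hw : ∀ z, 2 * (z ⬝ᵥ P *ᵥ (M.closedA w i (K i) *ᵥ z)) ≤ -(z ⬝ᵥ P *ᵥ z))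
    {τ₀ : ℝ} (hτ : 0 < τ₀) {s : SwitchingSignal κ τ₀} {z : M.Signals}
    (hz : z.IsTrajectory (Gains.ofAug K L) w G s) :
    Filter.Tendsto (fun t => z.e (Gains.ofAug K L) w i t) Filter.atTop (𝓝 0) := by
  obtain ⟨R, Y, hcomm, hRY, T, hT⟩ := M.exists_internal_model_error w i (K i)
  set ρ : ℝ → M.AugIdx i → ℝ := fun t => R *ᵥ z.joint i t + Y *ᵥ z.v t with hρ
  set ε : Fin N → ℝ → Fin m → ℝ := fun j t => z.η j t - z.v t with hε
  have hρ' : ∀ k, ∀ t ∈ Set.Ico (s.t k) (s.t (k + 1)), HasDerivWithinAt ρ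
      (M.closedA w i (K i) *ᵥ ρ t + (R * M.augE i) *ᵥ ε i t)
      (Set.Ico (s.t k) (s.t (k + 1))) t := by
    intro k t ht
    refine (((hz.deriv_joint i k ht).mulVec R).add ((hz.deriv_v k t ht).mulVec Y)).congr_deriv ?_
    have h1 : Y *ᵥ (M.S *ᵥ z.v t) =
        M.closedA w i (K i) *ᵥ (Y *ᵥ z.v t) - (R * M.augE i) *ᵥ z.v t := by
      rw [Matrix.mulVec_mulVec, Matrix.mulVec_mulVec, ← hRY, Matrix.add_mulVec]; abel
    have h2 : R *ᵥ (M.closedA w i (K i) *ᵥ z.joint i t) =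
        M.closedA w i (K i) *ᵥ (R *ᵥ z.joint i t) := by
      rw [Matrix.mulVec_mulVec, hcomm.eq, ← Matrix.mulVec_mulVec]
    simp only [hρ, hε, Matrix.mulVec_add, Matrix.mulVec_sub, h1, h2, Matrix.mulVec_mulVec _ R]
    abel
  obtain ⟨c, hc, hcle⟩ := hQ.exists_quadForm_le ((R * M.augE i)ᵀ * (P * (R * M.augE i)))
  have hcle' : ∀ x, ((R * M.augE i) *ᵥ x) ⬝ᵥ P *ᵥ ((R * M.augE i) *ᵥ x) ≤ c * (x ⬝ᵥ Q *ᵥ x) := by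
    intro x
    refine le_of_eq_of_le ?_ (hcle x)
    rw [← Matrix.mulVec_mulVec x _ (P * _), ← Matrix.mulVec_mulVec x P,
      Matrix.dotProduct_mulVec x, Matrix.vecMul_transpose]
  -- The weight `2 c` is twice what is needed to absorb the forcing of `ρ` by `ε i`.
  set V : ℝ → ℝ := fun t => ρ t ⬝ᵥ P *ᵥ ρ t + 2 * c * ∑ j, ε j t ⬝ᵥ Q *ᵥ ε j t with hV
  have hVt : Filter.Tendsto V Filter.atTop (𝓝 0) := by
    refine s.tendsto_zero hτ (c := 1 / 2) (by norm_num) ?_ ?_ ?_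
    · have hcε : ∀ j, ContinuousOn (ε j) (Set.Ici 0) := fun j => (hz.cont_η j).sub hz.cont_v
      have hcj : ContinuousOn (z.joint i) (Set.Ici 0) := by
        refine continuousOn_pi.2 ?_
        rintro (r | r)
        · exact continuousOn_pi.1 (hz.cont_x i) r
        · exact continuousOn_pi.1 (hz.cont_ξ i) r
      have hcρ : ContinuousOn ρ (Set.Ici 0) :=
        ((by fun_prop : Continuous fun x => R *ᵥ x).comp_continuousOn hcj).add
          ((by fun_prop : Continuous fun x => Y *ᵥ x).comp_continuousOn hz.cont_v)
      refine ((by fun_prop : Continuous fun x => x ⬝ᵥ P *ᵥ x).comp_continuousOn hcρ).add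
        (continuousOn_const.mul (continuousOn_finsetSum _ fun j _ => ?_))
      exact (by fun_prop : Continuous fun x => x ⬝ᵥ Q *ᵥ x).comp_continuousOn (hcε j)
    · intro t
      exact add_nonneg (hP.quadForm_nonneg _)
        (mul_nonneg (by positivity) (Finset.sum_nonneg fun j _ => hQ.quadForm_nonneg _))
    · intro k t ht
      refine ⟨_, (hP.hasDerivWithinAt_quadForm (hρ' k t ht)).add
        ((HasDerivWithinAt.fun_sum fun j _ =>
          hQ.hasDerivWithinAt_quadForm (hz.deriv_observer j k ht)).const_mul (2 * c)), ?_⟩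
      have h1 := hL (s.σ t) fun j => ε j t
      have h2 := hw (ρ t)
      have h3 := hP.two_mul_dotProduct_le (ρ t) ((R * M.augE i) *ᵥ ε i t)
      have h4 := hcle' (ε i t)
      have h5 : ε i t ⬝ᵥ Q *ᵥ ε i t ≤ ∑ j, ε j t ⬝ᵥ Q *ᵥ ε j t :=
        Finset.single_le_sum (f := fun j => ε j t ⬝ᵥ Q *ᵥ ε j t)
          (fun j _ => hQ.quadForm_nonneg _) (Finset.mem_univ i)
      have h6 := mul_le_mul_of_nonneg_left h1 (by positivity : 0 ≤ 2 * c)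
      have h7 := mul_le_mul_of_nonneg_left h5 hc.le
      have h8 : 0 ≤ ∑ j, ε j t ⬝ᵥ Q *ᵥ ε j t :=
        Finset.sum_nonneg fun j _ => hQ.quadForm_nonneg _
      have h9 := mul_nonneg hc.le h8
      rw [Matrix.mulVec_add, dotProduct_add]
      refine (add_le_add_right h6 _).trans ?_
      simp only [hV]
      linarith
  have hρt : Filter.Tendsto ρ Filter.atTop (𝓝 0) := by
    refine hP.tendsto_zero_of_quadForm (squeeze_zero (fun t => hP.quadForm_nonneg _)
      (fun t => ?_) hVt)
    exact le_add_of_nonneg_right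
      (mul_nonneg (by positivity) (Finset.sum_nonneg fun j _ => hQ.quadForm_nonneg _))
  have he : ∀ t, z.e (Gains.ofAug K L) w i t = T *ᵥ ρ t := by
    intro t
    rw [Signals.e, Signals.y_ofAug, Signals.y₀, sub_neg_eq_add, hT]
  simp only [he]
  have hTc : Continuous fun x => T *ᵥ x := by fun_prop
  have h := (hTc.tendsto 0).comp hρt
  rwa [Matrix.mulVec_zero] at h

end ConsensusTracking.MultiAgentSystem

theorem theorem1 {N q m κ : ℕ} (M : ConsensusTracking.MultiAgentSystem N q m)
    (G : Fin κ → ConsensusTracking.CommGraph N)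
    (hctrl : ∀ i, ConsensusTracking.Controllable (M.A i) (M.B i))
    (hobs : ∀ i, ConsensusTracking.Observable (M.C i) (M.A i))
    (hleader : ConsensusTracking.Observable M.F M.S)
    (hgraph : ∀ k, (G k).Connected)
    (htrans : M.TransmissionZeroCondition) :
    ∃ K : M.Gains, ConsensusTracking.MultiAgentSystem.SolvesRobustConsensusTracking K G := by
  obtain ⟨L, Q, hQ, hL⟩ := ConsensusTracking.exists_observer_gain hleader hgraph
  choose K P hP hK using fun i => exists_gain_of_controllable (M.augA 0 i) (M.augB 0 i)
    (M.augmented_controllable (hctrl i) htrans)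
  have hev := Filter.eventually_all.2 fun i => M.eventually_decay (hP i) (hK i)
  obtain ⟨W, hW, hWo, h0⟩ := eventually_nhds_iff.1 hev
  exact ⟨.ofAug K L, W, hWo, h0, fun w hw τ₀ hτ s z hz i =>
    ConsensusTracking.MultiAgentSystem.tendsto_error hQ hL (hP i) (hW w hw i) hτ hz⟩
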